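/- **Sharp SQ hardness of Massart halfspaces for large $\eta$.** *Setting.* A halfspace on $\mathbb{R}^M$ is a function $f(x)=\mathrm{sign}(w\cdot x-\theta)\in\{\pm1\}$, with $w\in\mathbb{R}^M$, $\theta\in\mathbb{R}$, $\mathrm{sign}(t)=1$ iff $t\ge 0$. A distribution $D$ on $\mathbb{R}^M\times\{\pm1\}$ is a halfspace with $\eta$-Massart noise if there are a probability distribution $D_x$ on $\mathbb{R}^M$, a halfspace $f$ and a measurable $\eta(\cdot):\mathbb{R}^M\to[0,\eta]$ such that $(x,y)\sim D$ is generated by $x\sim D_x$ and, given $x$, $y=f(x)$ with probability $1-\eta(x)$ and $y=-f(x)$ with probability $\eta(x)$. Its optimal error is $\inf_g \Pr_{(x,y)\sim D}[g(x)\neq y]$ over halfspaces $g$. A (possibly randomized, adaptive, computationally unbounded) SQ algorithm asks queries $q:\mathbb{R}^M\times\{\pm1\}\to[-1,1]$; a query of tolerance $\tau$ is answered by an arbitrary value in $[\mathbf{E}_D[q]-\tau,\mathbf{E}_D[q]+\tau]$. For parameters $M,\eta,\mathrm{OPT}$ we say that *no SQ algorithm with at most $1/\tau$ queries of tolerance $\tau$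 learns to error better than $e$* if there is no SQ algorithm which, for every halfspace distribution $D$ on $\mathbb{R}^M$ with $\eta$-Massart noise and optimal error at most $\mathrm{OPT}$, and for every valid oracle, makes at most $1/\tau$ queries and outputs, with probability at least $2/3$, a hypothesis $h:\mathbb{R}^M\to\{\pm1\}$ with $\Pr_{(x,y)\sim D}[h(x)\ne y]<e$. For $\kappa>0$ write $$\tau_\kappa(M,\mathrm{OPT})=M^{-\kappa\,\frac{\log M}{(\log\log M)^3}/\log(1/\mathrm{OPT})}.$$ *Theorem.* There are universal constants $C,K>0$ such that the following holds. 1. For every $c>0$ there is $\kappa>0$, depending only on $c$, such that for all $M\in\mathbb{Z}_+$, $\mathrm{OPT}>0$ and $\eta$ with $$\frac{\log M}{(\log\log M)^3}\ \ge\ C\log(1/\mathrm{OPT}),\qquad \mathrm{OPT}<\eta\le \tfrac12,\qquad c\ge K\sqrt{\tfrac12-\eta},$$ no SQ algorithm with at most $1/\tau$ queries of tolerance $\tau=\tau_\kappa(M,\mathrm{OPT})$ learns halfspaces on $\mathbb{R}^M$ with $\eta$-Massart noise and optimal error at most $\mathrm{OPT}$ to error better than $\tfrac12-c$. 2. In particular,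 with the same $\kappa$: for every $c'\in(0,1)$ there is $M_0$ such that for all $M\ge M_0$ and all $\eta$ with $\exp(-\log^{c'}M)<\eta\le\frac12$ and $c\ge K\sqrt{\frac12-\eta}$, the conclusion of 1 holds with $\mathrm{OPT}=\exp(-\log^{c'}M)$. 3. Consequently the error lower bound is $\eta-o_\eta(1)$: there is a function $g$ with $g(\eta)\to0$ as $\eta\to\frac12^-$ such that for every $\eta\in(0,\frac12)$ there is $\kappa>0$ such that for every $c'\in(0,1)$ there is $M_0$ such that for all $M\ge M_0$ and $\mathrm{OPT}=\exp(-\log^{c'}M)$, no SQ algorithm with at most $1/\tau$ queries of tolerance $\tau=\tau_\kappa(M,\mathrm{OPT})$ learns halfspaces on $\mathbb{R}^M$ with $\eta$-Massart noise and optimal error at most $\mathrm{OPT}$ to error better than $\eta-g(\eta)$. -/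

import Mathlib

open MeasureTheory Filter Topology

noncomputable section

namespace MassartSQ

/-! ### Halfspaces and Massart noise

Labels `{±1}` are encoded by `Bool`: `true` is `+1`, `false` is `-1`, and `!y` is `-y`. -/

/-- The domain `ℝ^M`. -/
abbrev Dom (M : ℕ) : Type := EuclideanSpace ℝ (Fin M)

/-- The halfspace `x ↦ sign (w ⬝ x - θ)`, where `sign t = +1` if `t ≥ 0` and `-1` otherwise. -/
def halfspace {M : ℕ} (w : Dom M) (θ : ℝ) (x : Dom M) : Bool :=
  decide (0 ≤ inner ℝ w x - θ)

section General

variable {X : Type} [MeasurableSpace X]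

/-- The law of `(x, y)` where `x ∼ Dx` and, given `x`, `y = f x` with probability `1 - ν x` and
`y = - f x` with probability `ν x`. -/
def noisyLaw (Dx : Measure X) (f : X → Bool) (ν : X → ℝ) : Measure (X × Bool) :=
  (Dx.withDensity fun x => ENNReal.ofReal (1 - ν x)).map (fun x => (x, f x)) +
    (Dx.withDensity fun x => ENNReal.ofReal (ν x)).map (fun x => (x, !f x))

end General

/-- `D` is the distribution of labelled examples of some halfspace on `ℝ^M` with Massart noise of
rate at most `η`. -/
def IsMassartHalfspace (M : ℕ) (η : ℝ) (D : Measure (Dom M × Bool)) : Prop :=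
  ∃ (Dx : Measure (Dom M)) (w : Dom M) (θ : ℝ) (ν : Dom M → ℝ),
    IsProbabilityMeasure Dx ∧ Measurable ν ∧ (∀ x, 0 ≤ ν x ∧ ν x ≤ η) ∧
      D = noisyLaw Dx (halfspace w θ) ν

/-- The optimal misclassification error over halfspaces, `inf_g Pr_{(x,y) ∼ D} [g x ≠ y]`. -/
def optError {M : ℕ} (D : Measure (Dom M × Bool)) : ENNReal :=
  ⨅ (w : Dom M) (θ : ℝ), D {z | halfspace w θ z.1 ≠ z.2}

/-- The learning problem: halfspaces on `ℝ^M` with `η`-Massart noise, under the promise that the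
optimal misclassification error is at most `OPT`. -/
def massartHalfspaces (M : ℕ) (η OPT : ℝ) : Set (Measure (Dom M × Bool)) :=
  {D | IsMassartHalfspace M η D ∧ optError D ≤ ENNReal.ofReal OPT}

/-! ### Statistical query algorithms -/

/-- A statistical query: a measurable function of a labelled example with values in `[-1, 1]`. -/
structure Query (X : Type) [MeasurableSpace X] where
  toFun : X × Bool → ℝ
  measurable_toFun : Measurable toFun
  mem_Icc : ∀ z, toFun z ∈ Set.Icc (-1 : ℝ) 1

/-- A measurable hypothesis `h : X → {±1}`. -/
structure Hypothesis (X : Type) [MeasurableSpace X] where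
  toFun : X → Bool
  measurable_toFun : Measurable toFun

/-- A deterministic adaptive statistical query algorithm: it either outputs a hypothesis, or asks
a query and continues in a way that depends on the (real) answer. No bound on its computational
resources is imposed. -/
inductive SQAlgorithm (X : Type) [MeasurableSpace X] : Type
  | output (h : Hypothesis X) : SQAlgorithm X
  | ask (q : Query X) (next : ℝ → SQAlgorithm X) : SQAlgorithm X

section General

variable {X : Type} [MeasurableSpace X]

/-- The hypothesis that the algorithm outputs when its queries are answered by `O`. -/
def SQAlgorithm.run (O : Query X → ℝ) : SQAlgorithm X → Hypothesis X
  | .output h => h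
  | .ask q next => (next (O q)).run O

/-- The number of queries that the algorithm makes when its queries are answered by `O`. -/
def SQAlgorithm.numQueries (O : Query X → ℝ) : SQAlgorithm X → ℕ
  | .output _ => 0
  | .ask q next => (next (O q)).numQueries O + 1

/-- `O` is a valid `STAT(τ)` oracle for `D`: every query is answered up to an additive `τ`. -/
def IsSTAT (D : Measure (X × Bool)) (τ : ℝ) (O : Query X → ℝ) : Prop :=
  ∀ q : Query X,
    O q ∈ Set.Icc ((∫ z, q.toFun z ∂D) - τ) ((∫ z, q.toFun z ∂D) + τ)

/-- The misclassification error `Pr_{(x,y) ∼ D} [h x ≠ y]`. -/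
def misclassError (D : Measure (X × Bool)) (h : Hypothesis X) : ℝ :=
  D.real {z | h.toFun z.1 ≠ z.2}

/-- The randomized SQ algorithm `A` (its random seed `ω` has law `P`) learns the class `𝒟` to error
better than `e` with at most `1 / τ` queries of tolerance `τ`: for every `D ∈ 𝒟` and every valid
`STAT(τ)` oracle for `D`, it never makes more than `1 / τ` queries, and with probability at least
`2 / 3` over the seed it outputs a hypothesis of error less than `e`. (The success event is only
required to contain a measurable event of that probability.) -/
def Learns {Ω : Type} [MeasurableSpace Ω] (P : Measure Ω) (A : Ω → SQAlgorithm X)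
    (𝒟 : Set (Measure (X × Bool))) (τ e : ℝ) : Prop :=
  ∀ D ∈ 𝒟, ∀ O : Query X → ℝ, IsSTAT D τ O →
    (∀ ω, ((A ω).numQueries O : ℝ) ≤ 1 / τ) ∧
    ∃ E : Set Ω, MeasurableSet E ∧ 2 / 3 ≤ P.real E ∧
      ∀ ω ∈ E, misclassError D ((A ω).run O) < e

end General

/-- No SQ algorithm, even randomized, learns halfspaces on `ℝ^M` with `η`-Massart noise to error
better than `e` with at most `1 / τ` queries of tolerance `τ`, even under the promise that the
optimal misclassification error is at most `OPT`. -/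
def SQHard (M : ℕ) (η OPT τ e : ℝ) : Prop :=
  ∀ (Ω : Type) [MeasurableSpace Ω] (P : Measure Ω) [IsProbabilityMeasure P]
    (A : Ω → SQAlgorithm (Dom M)), ¬ Learns P A (massartHalfspaces M η OPT) τ e

/-- `log M / (log log M)^3`. -/
def logRatio (M : ℕ) : ℝ := Real.log M / Real.log (Real.log M) ^ 3

/-- `τ = M ^ (-κ (log M / (log log M)^3) / log (1 / OPT))`. -/
def tol (κ : ℝ) (M : ℕ) (OPT : ℝ) : ℝ :=
  (M : ℝ) ^ (-(κ * (logRatio M / Real.log (1 / OPT))))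

end MassartSQ

end

/-! Hide the labels in one direction of a product space. On the cube `cubeMeasure n`, each of the
2^n selections `v` of one coordinate from every pair gives a sum `proj v`. Positive and negative
examples are weighted by two comb densities in z = `proj v`: mixtures over ξ in [1, 1 + ε] of the
scaled lattices (ℤ + 1/4)/ξ and (ℤ - 1/4)/ξ, the negative one multiplied by β = (2J - 1)/(2J + 1).

Why queries fail: averaging over a unit interval nearly annihilates a mean-zero function of period
1/ξ, so a comb density minus 1 decays like ε^r under r averagings
(`abs_avg_iterate_combDensity_le`). Two selections at Hamming distance r each use r independent
coordinates that the other ignores, so their combs have correlation of order ε^r, up to a factor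
polynomial in 1/ε. Summing over pairs and applying Cauchy-Schwarz, a bounded query has exponentially
small correlation with the comb of a typical selection (`sum_abs_integral_mul_proj_le`). Hence the
answers obtained by flattening both combs to 1 are valid for almost every `v`, and a learner that
sees only these answers cannot find `v` (`not_learns_of_family`). In the flattened picture the label
is independent of the point, and its minority fraction is β/(1 + β) = 1/2 - 1/(4J); so no hypothesis
beats 1/2 - c by much once J is about 1/c.

Why these are Massart halfspaces: at z the two densities are proportional to A and βB, where A and B
count lattice points between z and (1 + ε)z and differ by at most one. Since β lies strictly between
(J - 1)/J and J/(J + 1), the negative label wins exactly when B = A + 1 ≤ J. This happens on O(J²/ε)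
intervals, so the majority label is the sign of a polynomial in `proj v` of that degree
(`exists_roots`), and listing products of coordinates turns it into a halfspace
(`exists_embedding`). The winning margin is of order 1/J², which is where c ≥ K√(1/2 - η) comes
from. For |z| < 1/(2ε) at most one of A, B is nonzero and there is no noise, so the optimal error is
governed by the subgaussian tail of `proj v`.

With Λ = log(1/OPT), the choice ε = 1/√(8nΛ) makes that tail smaller than OPT, and n about log M ·
`logRatio M` / Λ is the largest scale at which the monomials still fit into dimension M. Bounded M
is treated separately by shrinking κ until the tolerance hides the bias of a single noisy label. -/

open MeasureTheory Filter Topology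

noncomputable section

namespace MassartSQ

/-! ### Lower bound from uninformative oracle answers -/

section AbstractLowerBound

variable {X : Type} [MeasurableSpace X]

/-- The first (at most) `N` queries asked when the answers come from `O`. -/
def SQAlgorithm.firstQueries (O : Query X → ℝ) : SQAlgorithm X → ℕ → List (Query X)
  | .output _, _ => []
  | .ask _ _, 0 => []
  | .ask q next, N + 1 => q :: (next (O q)).firstQueries O N

theorem SQAlgorithm.length_firstQueries_le (O : Query X → ℝ) (A : SQAlgorithm X) (N : ℕ) :
    (A.firstQueries O N).length ≤ N := by
  induction A generalizing N with
  | output h => simp [firstQueries]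
  | ask q next ih =>
    cases N with
    | zero => simp [firstQueries]
    | succ N => simpa [firstQueries] using ih (O q) N

/-- The queries are listed along the run on `O`, but the length bound concerns only `O'`: in the
application `O` need not be a valid oracle for any distribution, so nothing bounds its run, and
truncating the list at `N` suffices. -/
theorem SQAlgorithm.run_congr {O O' : Query X → ℝ} (A : SQAlgorithm X) (N : ℕ)
    (hN : A.numQueries O' ≤ N) (h : ∀ q ∈ A.firstQueries O N, O' q = O q) :
    A.run O' = A.run O := by
  induction A generalizing N with
  | output h => rfl
  | ask q next ih =>
    cases N with
    | zero => simp [numQueries] at hN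
    | succ N =>
      simp only [firstQueries, List.mem_cons, forall_eq_or_imp] at h
      simp only [numQueries, h.1, add_le_add_iff_right] at hN
      simp only [run, h.1]
      exact ih (O q) N hN h.2

open Classical in
/-- If the answers `R` are, for every query, valid for all but a `β` fraction of the distributions
`D i`, and every hypothesis is good for at most a `β'` fraction of them, then few queries do not
suffice to learn. -/
theorem not_learns_of_family {ι : Type} [Fintype ι] [Nonempty ι] (D : ι → Measure (X × Bool))
    (𝒟 : Set (Measure (X × Bool))) (hD : ∀ i, D i ∈ 𝒟) (R : Query X → ℝ) {τ e β β' : ℝ}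
    (hτ : 0 ≤ τ)
    (hq : ∀ q : Query X, ((Finset.univ.filter
      fun i => τ < |(∫ z, q.toFun z ∂(D i)) - R q|).card : ℝ) ≤ β * Fintype.card ι)
    (hh : ∀ h : Hypothesis X, ((Finset.univ.filter
      fun i => misclassError (D i) h < e).card : ℝ) ≤ β' * Fintype.card ι)
    (hβ : β / τ + β' < 2 / 3)
    {Ω : Type} [MeasurableSpace Ω] (P : Measure Ω) [IsProbabilityMeasure P]
    (A : Ω → SQAlgorithm X) : ¬ Learns P A 𝒟 τ e := by
  intro hL
  let bad : Query X → Finset ι := fun q =>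
    Finset.univ.filter fun i => τ < |(∫ z, q.toFun z ∂(D i)) - R q|
  -- The adversary gives the common answer `R q` whenever it is valid for `D i`, and the exact
  -- expectation otherwise.
  let O : ι → Query X → ℝ := fun i q => if i ∈ bad q then ∫ z, q.toFun z ∂(D i) else R q
  have hO : ∀ i, IsSTAT (D i) τ (O i) := by
    intro i q
    by_cases h : i ∈ bad q
    · simp only [O, h, if_true, Set.mem_Icc]
      constructor <;> linarith
    · simp only [O, h, if_false, Set.mem_Icc]
      simp only [bad, Finset.mem_filter, Finset.mem_univ, true_and, not_lt] at h
      have := abs_le.mp h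
      constructor <;> linarith [this.1, this.2]
  have hc : (0 : ℝ) < Fintype.card ι := by exact_mod_cast Fintype.card_pos
  have hβ0 : 0 ≤ β := by
    have := (Nat.cast_nonneg _).trans (hq ⟨fun _ => 0, measurable_const, fun _ => by simp⟩)
    exact nonneg_of_mul_nonneg_left this hc
  choose E hEm hEP hEs using fun i => (hL (D i) (hD i) (O i) (hO i)).2
  have hnum : ∀ i ω, (A ω).numQueries (O i) ≤ ⌊1 / τ⌋₊ := fun i ω =>
    Nat.le_floor ((hL (D i) (hD i) (O i) (hO i)).1 ω)
  have key : ∀ ω, ((Finset.univ.filter fun i => ω ∈ E i).card : ℝ) ≤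
      (β / τ + β') * Fintype.card ι := by
    intro ω
    -- For a fixed seed this list does not depend on `i`. Unless `i` is bad for one of its members,
    -- the run against `O i` is the run against `R`. The bound on successful indices per seed is
    -- then integrated over the seed.
    let Qs := (A ω).firstQueries R ⌊1 / τ⌋₊
    have hsub : (Finset.univ.filter fun i => ω ∈ E i) ⊆
        (Qs.toFinset.biUnion bad) ∪
          Finset.univ.filter fun i => misclassError (D i) ((A ω).run R) < e := by
      intro i hi
      simp only [Finset.mem_filter, Finset.mem_univ, true_and] at hi
      by_cases hb : i ∈ Qs.toFinset.biUnion bad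
      · exact Finset.mem_union_left _ hb
      · apply Finset.mem_union_right
        simp only [Finset.mem_biUnion, List.mem_toFinset, not_exists, not_and] at hb
        have hrun := SQAlgorithm.run_congr (O := R) (O' := O i) (A ω) _ (hnum i ω)
          (fun q hq => by simp [O, hb q hq])
        simpa [← hrun] using hEs i ω hi
    have h1 := (Finset.card_le_card hsub).trans (Finset.card_union_le _ _)
    have h2 : ((Qs.toFinset.biUnion bad).card : ℝ) ≤ (1 / τ) * (β * Fintype.card ι) := by
      have h3 : ((Qs.toFinset.biUnion bad).card : ℝ) ≤ ∑ q ∈ Qs.toFinset, ((bad q).card : ℝ) := by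
        exact_mod_cast Finset.card_biUnion_le
      have h4 : (Qs.toFinset.card : ℝ) ≤ 1 / τ := by
        have : Qs.toFinset.card ≤ ⌊1 / τ⌋₊ :=
          (List.toFinset_card_le _).trans (SQAlgorithm.length_firstQueries_le _ _ _)
        exact (Nat.cast_le.mpr this).trans (Nat.floor_le (by positivity))
      calc _ ≤ _ := h3
        _ ≤ ∑ q ∈ Qs.toFinset, β * Fintype.card ι := Finset.sum_le_sum fun q _ => hq q
        _ = Qs.toFinset.card * (β * Fintype.card ι) := by simp
        _ ≤ _ := by gcongr
    have h5 := hh ((A ω).run R)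
    have h1' := (Nat.cast_le (α := ℝ)).mpr h1
    push_cast at h1'
    calc _ ≤ _ := h1'
      _ ≤ (1 / τ) * (β * Fintype.card ι) + β' * Fintype.card ι := add_le_add h2 h5
      _ = _ := by ring
  have hsum : ∑ i, P.real (E i) ≤ (β / τ + β') * Fintype.card ι := by
    have : ∑ i, P.real (E i) = ∫ ω, ∑ i, (E i).indicator (fun _ => (1 : ℝ)) ω ∂P := by
      rw [integral_finsetSum]
      · simp [integral_indicator, hEm]
      · intro i _
        exact (integrable_const 1).indicator (hEm i)
    rw [this]
    calc _ ≤ ∫ ω, (β / τ + β') * Fintype.card ι ∂P := by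
          apply integral_mono
          · exact integrable_finsetSum _ fun i _ => (integrable_const 1).indicator (hEm i)
          · exact integrable_const _
          · intro ω
            refine le_trans (le_of_eq ?_) (key ω)
            simp [Set.indicator_apply]
      _ = _ := by simp
  have : ∑ i : ι, (2 / 3 : ℝ) ≤ ∑ i, P.real (E i) := Finset.sum_le_sum fun i _ => hEP i
  simp only [Finset.sum_const, Finset.card_univ, nsmul_eq_mul] at this
  nlinarith

end AbstractLowerBound

/-! ### Unit-interval averages of periodic functions -/

section Averaging

/-- The uniform distribution on `(-1/2, 1/2]`. -/
def unif : Measure ℝ := volume.restrict (Set.Ioc (-(1 / 2)) (1 / 2))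

instance : IsProbabilityMeasure unif := ⟨by simp [unif]; norm_num⟩

/-- The average of `f` over the unit interval centred at `z`. -/
def avg (f : ℝ → ℝ) (z : ℝ) : ℝ := ∫ x, f (z + x) ∂unif

theorem avg_eq_intervalIntegral (f : ℝ → ℝ) (z : ℝ) :
    avg f z = ∫ w in (z - 1 / 2)..(z + 1 / 2), f w := by
  unfold avg unif
  rw [← intervalIntegral.integral_of_le (by norm_num), intervalIntegral.integral_comp_add_left]
  congr 1

theorem measurable_avg_uncurry {k : ℝ → ℝ → ℝ} (hk : Measurable (Function.uncurry k)) :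
    Measurable (Function.uncurry fun ξ z => avg (k ξ) z) := by
  have : Measurable fun p : (ℝ × ℝ) × ℝ => k p.1.1 (p.1.2 + p.2) :=
    hk.comp (f := fun p : (ℝ × ℝ) × ℝ => (p.1.1, p.1.2 + p.2)) (by fun_prop)
  exact (this.stronglyMeasurable.integral_prod_right' (ν := unif)).measurable

theorem measurable_avg {f : ℝ → ℝ} (hf : Measurable f) : Measurable (avg f) := by
  have := measurable_avg_uncurry (k := fun _ => f) (hf.comp measurable_snd)
  exact this.comp (f := fun z : ℝ => ((0 : ℝ), z)) (by fun_prop)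

theorem abs_integral_le_of_abs_le {α : Type*} [MeasurableSpace α] (μ : Measure α)
    [IsProbabilityMeasure μ] {f : α → ℝ} {B : ℝ} (h : ∀ x, |f x| ≤ B) : |∫ x, f x ∂μ| ≤ B := by
  simpa using norm_integral_le_of_norm_le_const (μ := μ) (f := f) (C := B)
    (Eventually.of_forall h)

theorem integrable_of_abs_le {α : Type*} [MeasurableSpace α] {μ : Measure α}
    [IsFiniteMeasure μ] {f : α → ℝ} (hf : Measurable f) {B : ℝ} (h : ∀ x, |f x| ≤ B) :
    Integrable f μ :=
  Integrable.of_bound hf.aestronglyMeasurable B (Eventually.of_forall h)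

theorem abs_avg_le {f : ℝ → ℝ} {B : ℝ} (h : ∀ x, |f x| ≤ B) (z : ℝ) : |avg f z| ≤ B :=
  abs_integral_le_of_abs_le _ fun _ => h _

instance (a b : ℝ) : IsFiniteMeasure (volume.restrict (Set.uIoc a b)) :=
  inferInstanceAs (IsFiniteMeasure (volume.restrict (Set.Ioc _ _)))

theorem intervalIntegrable_of_abs_le {f : ℝ → ℝ} (hf : Measurable f) {B : ℝ} (h : ∀ x, |f x| ≤ B)
    (a b : ℝ) : IntervalIntegrable f volume a b := by
  rw [intervalIntegrable_iff]
  exact integrable_of_abs_le hf h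

/-- Averaging a periodic function of mean zero whose period `p` is close to `1`. -/
theorem abs_avg_le_of_periodic {f : ℝ → ℝ} (hf : Measurable f) {B p : ℝ} (h : ∀ x, |f x| ≤ B)
    (hp1 : p ≤ 1) (hper : Function.Periodic f p) (h0 : ∫ x in 0..p, f x = 0)
    (z : ℝ) : |avg f z| ≤ (1 - p) * B := by
  have hi := intervalIntegrable_of_abs_le hf h
  -- A unit interval is one full period, contributing zero, plus a remainder of length 1 - p.
  rw [avg_eq_intervalIntegral, ← intervalIntegral.integral_add_adjacent_intervals
    (hi (z - 1 / 2) (z - 1 / 2 + p)) (hi _ _), hper.intervalIntegral_add_eq (z - 1 / 2) 0,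
    zero_add, h0, zero_add]
  have := intervalIntegral.norm_integral_le_of_norm_le_const (a := z - 1 / 2 + p) (b := z + 1 / 2)
    (f := f) (C := B) (fun x _ => h x)
  rw [Real.norm_eq_abs] at this
  refine this.trans (le_of_eq ?_)
  rw [abs_of_nonneg (by linarith)]
  ring

theorem avg_periodic {f : ℝ → ℝ} {p : ℝ} (hper : Function.Periodic f p) :
    Function.Periodic (avg f) p := by
  intro z
  unfold avg
  congr 1
  ext x
  rw [show z + p + x = z + x + p by ring, hper]

theorem intervalIntegral_avg_eq_zero {f : ℝ → ℝ} (hf : Measurable f) {B p : ℝ}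
    (h : ∀ x, |f x| ≤ B)
    (hper : Function.Periodic f p) (h0 : ∫ x in 0..p, f x = 0) :
    ∫ z in 0..p, avg f z = 0 := by
  unfold avg
  rw [intervalIntegral_integral_swap]
  · have : ∀ x, ∫ z in 0..p, f (z + x) = 0 := by
      intro x
      rw [intervalIntegral.integral_comp_add_right, zero_add, add_comm p x,
        hper.intervalIntegral_add_eq x 0, zero_add, h0]
    simp [this]
  · apply integrable_of_abs_le (B := B)
    · exact hf.comp (by fun_prop)
    · intro x
      exact h _

/-- Averaging repeatedly a mixture of periodic functions of mean zero, with periods in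
`[1 / (1 + ε), 1]`, decreases it exponentially. -/
theorem abs_avg_iterate_mixture_le {ε : ℝ} (hε : 0 < ε) (r : ℕ) :
    ∀ (k : ℝ → ℝ → ℝ) (B : ℝ), Measurable (Function.uncurry k) → (∀ ξ z, |k ξ z| ≤ B) →
    (∀ ξ ∈ Set.Ioc 1 (1 + ε), Function.Periodic (k ξ) (1 / ξ)) →
    (∀ ξ ∈ Set.Ioc 1 (1 + ε), ∫ z in 0..1 / ξ, k ξ z = 0) →
    ∀ z, |avg^[r] (fun z => ∫ ξ in Set.Ioc 1 (1 + ε), k ξ z) z| ≤ ε ^ r * (B * ε) := by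
  -- Two bounds are carried: `B` shrinks by ε at each averaging but only for ξ in (1, 1 + ε], while
  -- `C` holds for all ξ, never changes, and serves only integrability.
  suffices H : ∀ (k : ℝ → ℝ → ℝ) (B C : ℝ), Measurable (Function.uncurry k) →
      (∀ ξ z, |k ξ z| ≤ C) → (∀ ξ ∈ Set.Ioc 1 (1 + ε), ∀ z, |k ξ z| ≤ B) →
      (∀ ξ ∈ Set.Ioc 1 (1 + ε), Function.Periodic (k ξ) (1 / ξ)) →
      (∀ ξ ∈ Set.Ioc 1 (1 + ε), ∫ z in 0..1 / ξ, k ξ z = 0) →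
      ∀ z, |avg^[r] (fun z => ∫ ξ in Set.Ioc 1 (1 + ε), k ξ z) z| ≤ ε ^ r * (B * ε) from
    fun k B h1 h2 h3 h4 => H k B B h1 h2 (fun ξ _ => h2 ξ) h3 h4
  induction r with
  | zero =>
    intro k B C hm _ hb _ _ z
    have := norm_setIntegral_le_of_norm_le_const (μ := volume) (s := Set.Ioc 1 (1 + ε))
      (f := fun ξ => k ξ z) (C := B) (by simp) (fun ξ hξ => hb ξ hξ z)
    simpa [Real.volume_real_Ioc, hε.le] using this
  | succ r ih =>
    intro k B C hm hC hb hper h0 z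
    have hmξ : ∀ ξ, Measurable (k ξ) := fun ξ => hm.of_uncurry_left
    have hswap : avg (fun z => ∫ ξ in Set.Ioc 1 (1 + ε), k ξ z) =
        fun z => ∫ ξ in Set.Ioc 1 (1 + ε), avg (k ξ) z := by
      ext z
      unfold avg
      rw [integral_integral_swap]
      apply integrable_of_abs_le (B := C)
      · exact hm.comp (f := fun p : ℝ × ℝ => (p.2, z + p.1)) (by fun_prop)
      · intro x
        exact hC _ _
    rw [Function.iterate_succ_apply, hswap]
    have := ih (fun ξ => avg (k ξ)) (ε * B) C (measurable_avg_uncurry hm)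
      (fun ξ z => abs_avg_le (hC ξ) z) ?_ (fun ξ hξ => avg_periodic (hper ξ hξ))
      (fun ξ hξ => intervalIntegral_avg_eq_zero (hmξ ξ) (hC ξ) (hper ξ hξ) (h0 ξ hξ)) z
    · refine this.trans (le_of_eq ?_)
      ring
    · intro ξ hξ z
      have hξ0 : 0 < ξ := by linarith [hξ.1]
      have hB : 0 ≤ B := (abs_nonneg _).trans (hb ξ hξ 0)
      refine (abs_avg_le_of_periodic (hmξ ξ) (hb ξ hξ) ?_ (hper ξ hξ) (h0 ξ hξ) z).trans ?_
      · rw [div_le_one hξ0]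
        exact hξ.1.le
      · gcongr
        have : 1 - 1 / ξ = (ξ - 1) / ξ := by field_simp
        rw [this, div_le_iff₀ hξ0]
        nlinarith [hξ.1, hξ.2]

end Averaging

/-! ### The comb densities and their size -/

section Comb

/-- The boundary points of the pieces: points `z` such that `z` or `(1 + ε) z` is in
`ℤ / 2 + 1 / 4`. -/
def breakpoints (ε : ℝ) : Set ℝ :=
  {z | ∃ k : ℤ, z = k / 2 + 1 / 4 ∨ (1 + ε) * z = k / 2 + 1 / 4}

/-- The signed number of points of `ℤ - a` in `(z, (1 + ε) z]`. -/
def combCount (ε a z : ℝ) : ℤ := ⌊(1 + ε) * z + a⌋ - ⌊z + a⌋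

open Classical in
/-- The density, relative to Lebesgue measure, of the mixture of the lattices `(ℤ - a) / ξ` for
`ξ` uniform in `[1, 1 + ε]`. -/
def combDensity (ε a z : ℝ) : ℝ :=
  if z ∈ breakpoints ε then 0 else combCount ε a z / (ε * z)

variable {ε a : ℝ}

theorem countable_breakpoints (hε : 0 < ε) : (breakpoints ε).Countable := by
  have : breakpoints ε ⊆ Set.range (fun k : ℤ => (k / 2 + 1 / 4 : ℝ)) ∪
      Set.range (fun k : ℤ => ((k / 2 + 1 / 4) / (1 + ε) : ℝ)) := by
    rintro z ⟨k, h | h⟩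
    · exact Or.inl ⟨k, h.symm⟩
    · refine Or.inr ⟨k, ?_⟩
      simp only [← h]
      field_simp
  exact ((Set.countable_range _).union (Set.countable_range _)).mono this

theorem measurable_combDensity (hε : 0 < ε) (a : ℝ) : Measurable (combDensity ε a) := by
  unfold combDensity combCount
  apply Measurable.ite (countable_breakpoints hε).measurableSet measurable_const
  have h1 : Measurable fun z : ℝ => ⌊(1 + ε) * z + a⌋ := Int.measurable_floor.comp (by fun_prop)
  have h2 : Measurable fun z : ℝ => ⌊z + a⌋ := Int.measurable_floor.comp (by fun_prop)
  have h3 : Measurable fun z : ℝ => ((⌊(1 + ε) * z + a⌋ - ⌊z + a⌋ : ℤ) : ℝ) :=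
    (measurable_from_top (f := fun n : ℤ => (n : ℝ))).comp (h1.sub h2)
  exact h3.div (by fun_prop)

theorem combCount_eq (ε a z : ℝ) :
    (combCount ε a z : ℝ) = ε * z - Int.fract ((1 + ε) * z + a) + Int.fract (z + a) := by
  unfold combCount Int.fract
  push_cast
  ring

theorem abs_combCount_le (hε : 0 < ε) (z : ℝ) : |(combCount ε a z : ℝ)| ≤ ε * |z| + 1 := by
  rw [combCount_eq]
  have h1 := Int.fract_nonneg ((1 + ε) * z + a)
  have h2 := Int.fract_lt_one ((1 + ε) * z + a)
  have h3 := Int.fract_nonneg (z + a)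
  have h4 := Int.fract_lt_one (z + a)
  have h5 : |ε * z| = ε * |z| := by rw [abs_mul, abs_of_pos hε]
  rw [← h5, abs_le]
  constructor <;> [have := neg_abs_le (ε * z); have := le_abs_self (ε * z)] <;> linarith

/-- The shifts ±1/4 keep both lattices away from the origin; this is what tames the singularity of
1/(εz) in `combDensity`. -/
theorem combCount_eq_zero (hε : 0 < ε) (hε' : ε ≤ 1 / 2) (ha : a = 1 / 4 ∨ a = -(1 / 4)) {z : ℝ}
    (hz : |z| < 1 / 6) : combCount ε a z = 0 := by
  have h := abs_lt.mp hz
  have h1 : |(1 + ε) * z| < 1 / 4 := by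
    rw [abs_mul, abs_of_pos (by linarith)]
    nlinarith [abs_nonneg z]
  have h1 := abs_lt.mp h1
  unfold combCount
  rcases ha with rfl | rfl
  · rw [Int.floor_eq_iff (z := 0) |>.mpr (by push_cast; constructor <;> linarith),
      Int.floor_eq_iff (z := 0) |>.mpr (by push_cast; constructor <;> linarith)]
    simp
  · rw [Int.floor_eq_iff (z := -1) |>.mpr (by push_cast; constructor <;> linarith),
      Int.floor_eq_iff (z := -1) |>.mpr (by push_cast; constructor <;> linarith)]
    simp

theorem combDensity_nonneg (hε : 0 < ε) (a z : ℝ) : 0 ≤ combDensity ε a z := by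
  unfold combDensity combCount
  split_ifs
  · rfl
  rcases le_total 0 z with hz | hz
  · have : ⌊z + a⌋ ≤ ⌊(1 + ε) * z + a⌋ := Int.floor_le_floor (by nlinarith)
    apply div_nonneg
    · exact_mod_cast sub_nonneg.mpr this
    · positivity
  · have : ⌊(1 + ε) * z + a⌋ ≤ ⌊z + a⌋ := Int.floor_le_floor (by nlinarith)
    apply div_nonneg_of_nonpos
    · exact_mod_cast sub_nonpos.mpr this
    · nlinarith

theorem combDensity_le_of_le_abs (hε : 0 < ε) {z t : ℝ} (ht : 0 < t) (hz : t ≤ |z|) :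
    combDensity ε a z ≤ 1 + 1 / (ε * t) := by
  unfold combDensity
  split_ifs
  · positivity
  have hz0 : 0 < |z| := ht.trans_le hz
  calc _ ≤ |(combCount ε a z / (ε * z) : ℝ)| := le_abs_self _
    _ = |(combCount ε a z : ℝ)| / (ε * |z|) := by rw [abs_div, abs_mul, abs_of_pos hε]
    _ ≤ (ε * |z| + 1) / (ε * |z|) := by gcongr; exact abs_combCount_le hε z
    _ = 1 + 1 / (ε * |z|) := by field_simp
    _ ≤ 1 + 1 / (ε * t) := by gcongr

theorem combDensity_le (hε : 0 < ε) (hε' : ε ≤ 1 / 2) (ha : a = 1 / 4 ∨ a = -(1 / 4)) (z : ℝ) :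
    combDensity ε a z ≤ 7 / ε := by
  rcases lt_or_ge |z| (1 / 6) with hz | hz
  · unfold combDensity
    rw [combCount_eq_zero hε hε' ha hz]
    simp
    positivity
  · refine (combDensity_le_of_le_abs hε (by norm_num) hz).trans ?_
    have : 1 ≤ 1 / ε := by rw [le_div_iff₀ hε]; linarith
    have h2 : 1 / (ε * (1 / 6)) = 6 * (1 / ε) := by field_simp
    have h3 : 7 / ε = 7 * (1 / ε) := by ring
    rw [h2, h3]
    linarith

theorem abs_combDensity_sub_one_le (hε : 0 < ε) (hε' : ε ≤ 1 / 2)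
    (ha : a = 1 / 4 ∨ a = -(1 / 4)) (z : ℝ) : |combDensity ε a z - 1| ≤ 8 / ε := by
  have h1 := combDensity_nonneg hε a z
  have h2 := combDensity_le hε hε' ha z
  have : 1 ≤ 1 / ε := by rw [le_div_iff₀ hε]; linarith
  have h4 : 8 / ε = 7 / ε + 1 / ε := by ring
  rw [abs_le, h4]
  constructor <;> linarith [show 0 ≤ 7 / ε by positivity]

end Comb

/-! ### Decay of the comb density under averaging -/

section CombAverage

variable {ε a : ℝ}

/-- An antiderivative of `combDensity ε a - 1`. -/
def combPrimitive (ε a z : ℝ) : ℝ :=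
  ∫ ξ in 1..(1 + ε), -(Int.fract (ξ * z + a) / (ε * ξ))

theorem continuousAt_fract_add {w : ℝ} (hw : ∀ k : ℤ, w + a ≠ k) :
    ContinuousAt (fun w => Int.fract (w + a)) w := by
  have h : ContinuousAt (Int.fract : ℝ → ℝ) (w + a) := by
    apply continuousAt_fract
    exact fun h => hw ⌊w + a⌋ h
  exact ContinuousAt.comp (f := fun w => w + a) h (by fun_prop)

theorem add_ne_intCast (ha : a = 1 / 4 ∨ a = -(1 / 4)) {w : ℝ}
    (hw : ∀ k : ℤ, w ≠ k / 2 + 1 / 4) (n : ℤ) : w + a ≠ n := by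
  rcases ha with rfl | rfl
  · intro h
    apply hw (2 * n - 1)
    push_cast
    linarith
  · intro h
    apply hw (2 * n)
    push_cast
    linarith

/-- Integration over ξ smooths the jumps of the fractional part: for fixed z only countably many ξ
put ξz + a on an integer, and none do at z = 0 because a is not an integer. -/
theorem continuous_combPrimitive (hε : 0 < ε) (ha : a = 1 / 4 ∨ a = -(1 / 4)) :
    Continuous (combPrimitive ε a) := by
  rw [continuous_iff_continuousAt]
  intro z
  unfold combPrimitive
  apply intervalIntegral.continuousAt_of_dominated_interval (bound := fun _ => 1 / ε)
  · refine Eventually.of_forall fun z => Measurable.aestronglyMeasurable ?_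
    exact ((Measurable.fract (by fun_prop)).div (by fun_prop)).neg
  · refine Eventually.of_forall fun z => Eventually.of_forall fun ξ hξ => ?_
    rw [Set.uIoc_of_le (by linarith)] at hξ
    rw [norm_neg, Real.norm_eq_abs, abs_div, abs_of_nonneg (Int.fract_nonneg _),
      abs_of_pos (by nlinarith [hξ.1])]
    apply div_le_div₀ zero_le_one (Int.fract_lt_one _).le hε
    nlinarith [hξ.1]
  · exact intervalIntegrable_const
  · have hc : ({ξ : ℝ | ∃ k : ℤ, ξ * z + a = k}).Countable := by
      rcases eq_or_ne z 0 with rfl | hz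
      · convert Set.countable_empty
        ext ξ
        simp only [mul_zero, Set.mem_ofPred_eq, Set.mem_empty_iff_false, iff_false, not_exists]
        apply add_ne_intCast ha
        intro k hk
        have h1 : (2 * k + 1 : ℝ) = 0 := by linarith
        have h2 : (2 * k + 1 : ℤ) = 0 := by exact_mod_cast h1
        omega
      · refine (Set.countable_range fun k : ℤ => ((k : ℝ) - a) / z).mono ?_
        rintro ξ ⟨k, hk⟩
        refine ⟨k, ?_⟩
        simp only [← hk]
        field_simp
        ring
    filter_upwards [hc.ae_notMem volume] with ξ hξ _
    have h : ContinuousAt (Int.fract : ℝ → ℝ) (ξ * z + a) :=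
      continuousAt_fract fun h => hξ ⟨⌊ξ * z + a⌋, h⟩
    exact ((ContinuousAt.comp (f := fun z => ξ * z + a) h (by fun_prop)).div_const _).neg

/-- The substitution w = ξz moves the dependence on z into the limits of integration, where it can
be differentiated. -/
theorem combPrimitive_eq (hε : 0 < ε) {z : ℝ} (hz : z ≠ 0) :
    combPrimitive ε a z = -(1 / ε) * ∫ w in z..((1 + ε) * z), Int.fract (w + a) / w := by
  have h := intervalIntegral.integral_comp_mul_right (a := 1) (b := 1 + ε)
    (fun w => Int.fract (w + a) / w) hz
  rw [one_mul, smul_eq_mul, eq_inv_mul_iff_mul_eq₀ hz] at h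
  rw [← h, ← mul_assoc, ← intervalIntegral.integral_const_mul]
  unfold combPrimitive
  apply intervalIntegral.integral_congr
  intro ξ hξ
  rw [Set.uIcc_of_le (by linarith)] at hξ
  have : ξ ≠ 0 := by linarith [hξ.1]
  simp only
  field_simp

theorem hasDerivAt_combPrimitive (hε : 0 < ε) (ha : a = 1 / 4 ∨ a = -(1 / 4)) {z : ℝ}
    (hz : z ≠ 0) (hzb : z ∉ breakpoints ε) :
    HasDerivAt (combPrimitive ε a) (combDensity ε a z - 1) z := by
  classical
  have hb1 : ∀ k : ℤ, z ≠ k / 2 + 1 / 4 := fun k h => hzb ⟨k, Or.inl h⟩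
  have hb2 : ∀ k : ℤ, (1 + ε) * z ≠ k / 2 + 1 / 4 := fun k h => hzb ⟨k, Or.inr h⟩
  have hzp : 0 < |z| := abs_pos.mpr hz
  -- Cutting the integrand off near 0 makes it integrable on every interval without changing it on
  -- the intervals between y and (1 + ε)y for y near z.
  set g : ℝ → ℝ := fun w => if |w| ≤ |z| / 2 then 0 else Int.fract (w + a) / w with hg
  have hgm : Measurable g := by
    apply Measurable.ite
    · exact measurableSet_le (by fun_prop) measurable_const
    · exact measurable_const
    · exact (Measurable.fract (by fun_prop)).div measurable_id
  have hgb : ∀ w, |g w| ≤ 2 / |z| := by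
    intro w
    simp only [hg]
    split_ifs with h
    · simp only [abs_zero]
      positivity
    · push Not at h
      rw [abs_div, abs_of_nonneg (Int.fract_nonneg _),
        show 2 / |z| = 1 / (|z| / 2) by field_simp]
      gcongr
      exact (Int.fract_lt_one _).le
  have hgi := intervalIntegrable_of_abs_le hgm hgb
  have hgc : ∀ w, |z| / 2 < |w| → (∀ k : ℤ, w ≠ k / 2 + 1 / 4) → ContinuousAt g w := by
    intro w hw hk
    have hw0 : w ≠ 0 := abs_pos.mp (by linarith)
    have h1 : ContinuousAt (fun w => Int.fract (w + a) / w) w :=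
      (continuousAt_fract_add (add_ne_intCast ha hk)).div continuousAt_id hw0
    apply h1.congr
    have : ∀ᶠ y in 𝓝 w, |z| / 2 < |y| := continuous_abs.continuousAt.eventually_const_lt hw
    filter_upwards [this] with y hy
    simp [hg, not_le.mpr hy]
  have hgd : ∀ w, |z| / 2 < |w| → (∀ k : ℤ, w ≠ k / 2 + 1 / 4) →
      HasDerivAt (fun u => ∫ x in 0..u, g x) (g w) w := fun w hw hk =>
    intervalIntegral.integral_hasDerivAt_right (hgi 0 w)
      hgm.stronglyMeasurable.stronglyMeasurableAtFilter (hgc w hw hk)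
  have hze : |(1 + ε) * z| = (1 + ε) * |z| := by rw [abs_mul, abs_of_pos (by linarith)]
  have hd1 := hgd z (by linarith) hb1
  have hd2 : HasDerivAt (fun u => ∫ x in 0..((1 + ε) * u), g x) ((1 + ε) * g ((1 + ε) * z)) z := by
    have := (hgd ((1 + ε) * z) (by rw [hze]; nlinarith) hb2).comp z
      ((hasDerivAt_id z).const_mul (1 + ε))
    simpa [mul_comm, Function.comp_def] using this
  have hd := (hd2.sub hd1).const_mul (-(1 / ε))
  have hval : -(1 / ε) * ((1 + ε) * g ((1 + ε) * z) - g z) = combDensity ε a z - 1 := by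
    have e1 : g z = Int.fract (z + a) / z := by
      simp only [hg]; rw [if_neg]; push Not; linarith
    have e2 : g ((1 + ε) * z) = Int.fract ((1 + ε) * z + a) / ((1 + ε) * z) := by
      simp only [hg]; rw [if_neg]; push Not; rw [hze]; nlinarith
    rw [e1, e2, combDensity, if_neg hzb, combCount_eq]
    field_simp
    ring
  rw [← hval]
  apply hd.congr_of_eventuallyEq
  have hn : ∀ᶠ y in 𝓝 z, |y - z| < |z| / 2 := by
    have : ContinuousAt (fun y => |y - z|) z := by fun_prop
    exact this.eventually_lt_const (by simp only [sub_self, abs_zero]; linarith)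
  filter_upwards [hn] with y hy
  have key : ∀ t, 1 ≤ t → |z| / 2 < |t * y| := by
    intro t ht
    rw [abs_mul, abs_of_pos (by linarith : 0 < t)]
    have : |z| ≤ |y - z| + |y| := by
      rw [abs_sub_comm]
      simpa using abs_add_le (z - y) y
    nlinarith
  have hy0 : y ≠ 0 := by
    have := key 1 le_rfl
    rw [one_mul] at this
    exact abs_pos.mp (by linarith)
  rw [combPrimitive_eq hε hy0, Pi.sub_apply, intervalIntegral.integral_interval_sub_left (hgi _ _) (hgi _ _)]
  congr 1
  have h := intervalIntegral.integral_comp_mul_right (a := 1) (b := 1 + ε)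
    (fun w => Int.fract (w + a) / w) hy0
  have h' := intervalIntegral.integral_comp_mul_right (a := 1) (b := 1 + ε) g hy0
  rw [one_mul, smul_eq_mul, eq_inv_mul_iff_mul_eq₀ hy0] at h h'
  rw [← h, ← h']
  congr 1
  apply intervalIntegral.integral_congr
  intro ξ hξ
  rw [Set.uIcc_of_le (by linarith)] at hξ
  simp only [hg]
  rw [if_neg]
  push Not
  exact key ξ hξ.1

/-- The fundamental theorem of calculus, with a countable exceptional set, shows one average to be a
mixture over ξ of mean-zero functions of period 1/ξ, the input needed by
`abs_avg_iterate_mixture_le`. Writing `max 1 ξ` for ξ changes nothing on the range of integration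
and keeps the kernel bounded for all ξ. -/
theorem avg_combDensity_sub_one (hε : 0 < ε) (hε' : ε ≤ 1 / 2) (ha : a = 1 / 4 ∨ a = -(1 / 4)) :
    avg (fun z => combDensity ε a z - 1) = fun z => ∫ ξ in Set.Ioc 1 (1 + ε),
      (Int.fract (ξ * (z - 1 / 2) + a) - Int.fract (ξ * (z + 1 / 2) + a)) / (ε * max 1 ξ) := by
  ext z
  have hm : Measurable fun z => combDensity ε a z - 1 :=
    (measurable_combDensity hε a).sub measurable_const
  have hfr : ∀ z, IntervalIntegrable (fun ξ => -(Int.fract (ξ * z + a) / (ε * ξ))) volume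
      1 (1 + ε) := by
    intro z
    rw [intervalIntegrable_iff, Set.uIoc_of_le (by linarith)]
    refine Integrable.of_bound (Measurable.aestronglyMeasurable ?_) (1 / ε) ?_
    · exact ((Measurable.fract (by fun_prop)).div (by fun_prop)).neg
    · refine ae_restrict_of_forall_mem measurableSet_Ioc fun ξ hξ => ?_
      rw [norm_neg, Real.norm_eq_abs, abs_div, abs_of_nonneg (Int.fract_nonneg _),
        abs_of_pos (by nlinarith [hξ.1])]
      apply div_le_div₀ zero_le_one (Int.fract_lt_one _).le hε
      nlinarith [hξ.1]
  rw [avg_eq_intervalIntegral, integral_eq_of_hasDerivAt_off_countable (combPrimitive ε a) _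
    ((countable_breakpoints hε).union (Set.countable_singleton 0))
    (continuous_combPrimitive hε ha).continuousOn
    (fun x hx => hasDerivAt_combPrimitive hε ha (fun h => hx.2 (Or.inr h))
      (fun h => hx.2 (Or.inl h)))
    (intervalIntegrable_of_abs_le hm (abs_combDensity_sub_one_le hε hε' ha) _ _)]
  unfold combPrimitive
  rw [← intervalIntegral.integral_sub (hfr _) (hfr _),
    ← intervalIntegral.integral_of_le (by linarith)]
  apply intervalIntegral.integral_congr
  intro ξ hξ
  rw [Set.uIcc_of_le (by linarith)] at hξ
  simp only
  rw [max_eq_right hξ.1]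
  ring

/-- The density `combDensity ε a` becomes extremely close to `1` after a few averagings. -/
theorem abs_avg_iterate_combDensity_le (hε : 0 < ε) (hε' : ε ≤ 1 / 2)
    (ha : a = 1 / 4 ∨ a = -(1 / 4)) (r : ℕ) (z : ℝ) :
    |avg^[r] (fun z => combDensity ε a z - 1) z| ≤ 8 / ε * ε ^ r := by
  cases r with
  | zero => simpa using abs_combDensity_sub_one_le hε hε' ha z
  | succ r =>
    rw [Function.iterate_succ_apply, avg_combDensity_sub_one hε hε' ha]
    have hfp : ∀ ξ c, 0 < ξ →
        Function.Periodic (fun z : ℝ => Int.fract (ξ * (z + c) + a)) (1 / ξ) := by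
      intro ξ c hξ z
      have : ξ * (z + 1 / ξ + c) + a = ξ * (z + c) + a + 1 := by field_simp; ring
      simp only [this, Int.fract_add_one]
    have hfm : ∀ ξ c : ℝ, Measurable (fun z : ℝ => Int.fract (ξ * (z + c) + a)) :=
      fun ξ c => Measurable.fract (by fun_prop)
    have hfb : ∀ w : ℝ, |Int.fract w| ≤ 1 := fun w => by
      rw [abs_of_nonneg (Int.fract_nonneg _)]
      exact (Int.fract_lt_one _).le
    refine (abs_avg_iterate_mixture_le hε r _ (1 / ε) ?_ ?_ ?_ ?_ z).trans ?_
    · refine ((Measurable.fract ?_).sub (Measurable.fract ?_)).div ?_ <;> fun_prop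
    · intro ξ z
      have h0 : 1 ≤ max 1 ξ := le_max_left _ _
      rw [abs_div, abs_of_pos (by positivity : 0 < ε * max 1 ξ)]
      apply div_le_div₀ zero_le_one _ hε (by nlinarith)
      have h1 := Int.fract_nonneg (ξ * (z - 1 / 2) + a)
      have h2 := Int.fract_lt_one (ξ * (z - 1 / 2) + a)
      have h3 := Int.fract_nonneg (ξ * (z + 1 / 2) + a)
      have h4 := Int.fract_lt_one (ξ * (z + 1 / 2) + a)
      rw [abs_le]
      constructor <;> linarith
    · intro ξ hξ z
      have hξ0 : 0 < ξ := by linarith [hξ.1]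
      have h1 := hfp ξ (-(1 / 2)) hξ0 z
      have h2 := hfp ξ (1 / 2) hξ0 z
      simp only [← sub_eq_add_neg] at h1
      simp only [h1, h2]
    · intro ξ hξ
      have hξ0 : 0 < ξ := by linarith [hξ.1]
      have hper : Function.Periodic (fun z : ℝ => Int.fract (ξ * z + a)) (1 / ξ) := by
        simpa using hfp ξ 0 hξ0
      have h1 : ∀ c, ∫ z in 0..1 / ξ, Int.fract (ξ * (z + c) + a) =
          ∫ z in 0..1 / ξ, Int.fract (ξ * z + a) := by
        intro c
        rw [intervalIntegral.integral_comp_add_right (fun z => Int.fract (ξ * z + a)), zero_add,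
          add_comm (1 / ξ) c, hper.intervalIntegral_add_eq c 0, zero_add]
      have hi : ∀ c, IntervalIntegrable (fun z : ℝ => Int.fract (ξ * (z + c) + a)) volume
          0 (1 / ξ) := fun c => intervalIntegrable_of_abs_le (hfm ξ c) (fun _ => hfb _) _ _
      rw [intervalIntegral.integral_div]
      simp only [sub_eq_add_neg _ (1 / 2 : ℝ)]
      rw [intervalIntegral.integral_sub (hi _) (hi _), h1, h1, sub_self, zero_div]
    -- The first averaging only produces the mixture and gains nothing; the lost power of ε is
    -- absorbed by the prefactor 8/ε.
    · have h1 : 1 / ε * ε = 1 := by field_simp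
      have h2 : 8 / ε * ε ^ (r + 1) = 8 * ε ^ r := by rw [pow_succ]; field_simp
      rw [h1, h2]
      nlinarith [pow_pos hε r]

end CombAverage

/-! ### Near-orthogonality of hidden projections -/

section Correlation

/-- The uniform distribution on the cube `((-1/2, 1/2] × (-1/2, 1/2])^n`. -/
def cubeMeasure (n : ℕ) : Measure (Fin n → ℝ × ℝ) := Measure.pi fun _ => unif.prod unif

instance (n : ℕ) : IsProbabilityMeasure (cubeMeasure n) := by
  unfold cubeMeasure; infer_instance

/-- One of the two coordinates of a pair. -/
def select (b : Bool) (y : ℝ × ℝ) : ℝ := if b then y.1 else y.2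

/-- The sum of the coordinates selected by `v`. -/
def proj {n : ℕ} (v : Fin n → Bool) (x : Fin n → ℝ × ℝ) : ℝ := ∑ j, select (v j) (x j)

theorem measurable_select (b : Bool) : Measurable (select b) := by
  cases b <;> [exact measurable_snd; exact measurable_fst]

theorem measurable_proj {n : ℕ} (v : Fin n → Bool) : Measurable (proj v) :=
  Finset.measurable_sum _ fun j _ => (measurable_select (v j)).comp (measurable_pi_apply j)

theorem proj_cons {n : ℕ} (v : Fin (n + 1) → Bool) (y : ℝ × ℝ) (x : Fin n → ℝ × ℝ) :
    proj v (Fin.cons y x) = select (v 0) y + proj (Fin.tail v) x := by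
  simp [proj, Fin.sum_univ_succ, Fin.tail]

theorem integral_cubeMeasure_succ {n : ℕ} {F : (Fin (n + 1) → ℝ × ℝ) → ℝ} (hF : Measurable F)
    {B : ℝ} (hB : ∀ x, |F x| ≤ B) :
    ∫ x, F x ∂(cubeMeasure (n + 1)) =
      ∫ y, ∫ x, F (Fin.cons y x) ∂(cubeMeasure n) ∂(unif.prod unif) := by
  have h := measurePreserving_piFinSuccAbove (α := fun _ : Fin (n + 1) => ℝ × ℝ)
    (fun _ => unif.prod unif) 0
  have h2 := (h.symm _).integral_comp' (g := F)
  unfold cubeMeasure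
  rw [← h2, integral_prod]
  · simp [MeasurableEquiv.piFinSuccAbove_symm_apply, Fin.insertNth_zero', Fin.insertNthEquiv]
  · exact integrable_of_abs_le (hF.comp (MeasurableEquiv.measurable _)) fun _ => hB _

/-- The law of `proj v` is an `n`-fold convolution of uniform distributions. -/
theorem integral_comp_proj {n : ℕ} (v : Fin n → Bool) {f : ℝ → ℝ} (hf : Measurable f) {B : ℝ}
    (hB : ∀ x, |f x| ≤ B) (a : ℝ) :
    ∫ x, f (a + proj v x) ∂(cubeMeasure n) = avg^[n] f a := by
  induction n generalizing f a with
  | zero => simp [proj]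
  | succ n ih =>
    rw [integral_cubeMeasure_succ (F := fun x => f (a + proj v x))
      (hf.comp (measurable_const.add (measurable_proj v))) (fun _ => hB _)]
    simp only [proj_cons, ← add_assoc]
    have hm : ∀ b, Measurable fun p : (ℝ × ℝ) × (Fin n → ℝ × ℝ) =>
        f (a + select b p.1 + proj (Fin.tail v) p.2) := fun b =>
      hf.comp ((measurable_const.add ((measurable_select b).comp measurable_fst)).add
        ((measurable_proj _).comp measurable_snd))
    rw [integral_integral_swap (integrable_of_abs_le (hm _) fun _ => hB _),
      Function.iterate_succ_apply, ← ih (Fin.tail v) (measurable_avg hf) (abs_avg_le hB)]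
    congr 1
    ext x
    have hsel : ∀ (b : Bool) (φ : ℝ → ℝ), Measurable φ → (∀ t, |φ t| ≤ B) →
        ∫ y, φ (select b y) ∂(unif.prod unif) = ∫ t, φ t ∂unif := by
      intro b φ hφ hb
      cases b
      · simpa [select] using integral_prod (μ := unif) (ν := unif) (fun y => φ y.2)
          (integrable_of_abs_le (hφ.comp measurable_snd) fun _ => hb _)
      · simpa [select] using integral_prod (μ := unif) (ν := unif) (fun y => φ y.1)
          (integrable_of_abs_le (hφ.comp measurable_fst) fun _ => hb _)
    rw [hsel (v 0) (fun t => f (a + t + proj (Fin.tail v) x)) (by fun_prop) (fun _ => hB _)]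
    unfold avg
    congr 1
    ext t
    ring_nf

theorem hammingDist_succ {n : ℕ} (v v' : Fin (n + 1) → Bool) :
    hammingDist v v' = (if v 0 ≠ v' 0 then 1 else 0) + hammingDist (Fin.tail v) (Fin.tail v') := by
  unfold hammingDist
  rw [Finset.card_filter, Finset.card_filter, Fin.sum_univ_succ]
  rfl

/-- Functions of two projections are nearly uncorrelated, when one of them is averaged out by the
coordinates that occur in only one of the projections. -/
theorem abs_integral_proj_mul_proj_le {n : ℕ} (v v' : Fin n → Bool) {f g : ℝ → ℝ}
    (hf : Measurable f) (hg : Measurable g) {B C D : ℝ} (hB : ∀ x, |f x| ≤ B) (hC : ∀ x, |g x| ≤ C)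
    (hD : ∀ x, |avg^[hammingDist v v'] f x| ≤ D) (a b : ℝ) :
    |∫ x, f (a + proj v x) * g (b + proj v' x) ∂(cubeMeasure n)| ≤ D * C := by
  induction n generalizing f a b with
  | zero =>
    have := hD a
    simp only [Subsingleton.elim v v', hammingDist_self,
      Function.iterate_zero, id] at this
    simp only [proj, Finset.univ_eq_empty, Finset.sum_empty, add_zero, integral_const,
      probReal_univ, one_smul, abs_mul]
    exact mul_le_mul this (hC b) (abs_nonneg _) ((abs_nonneg _).trans this)
  | succ n ih =>
    have hBC : ∀ s t, |f s * g t| ≤ B * C := fun s t => by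
      rw [abs_mul]
      exact mul_le_mul (hB s) (hC t) (abs_nonneg _) ((abs_nonneg _).trans (hB s))
    rw [integral_cubeMeasure_succ (F := fun x => f (a + proj v x) * g (b + proj v' x))
      ((hf.comp (measurable_const.add (measurable_proj v))).mul
      (hg.comp (measurable_const.add (measurable_proj v')))) (fun _ => hBC _ _)]
    simp only [proj_cons, ← add_assoc]
    rw [hammingDist_succ] at hD
    by_cases hv : v 0 = v' 0
    · simp only [hv, ne_eq, not_true_eq_false, if_false, zero_add] at hD
      exact abs_integral_le_of_abs_le _ fun y => ih _ _ hf hB hD _ _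
    -- Here one member of the pair enters only `f` and the other only `g`. Integrating the former
    -- first replaces `f` by `avg f` and uses up one unit of Hamming distance.
    · simp only [ne_eq, hv, not_false_eq_true, if_true, add_comm 1,
        Function.iterate_succ_apply] at hD
      have hm : ∀ t : ℝ, Measurable fun p : ℝ × (Fin n → ℝ × ℝ) =>
          f (a + p.1 + proj (Fin.tail v) p.2) * g (b + t + proj (Fin.tail v') p.2) := fun t =>
        (hf.comp ((measurable_const.add measurable_fst).add
          ((measurable_proj _).comp measurable_snd))).mul
        (hg.comp (measurable_const.add ((measurable_proj _).comp measurable_snd)))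
      have key : ∀ t, |∫ s, ∫ x, f (a + s + proj (Fin.tail v) x) *
          g (b + t + proj (Fin.tail v') x) ∂(cubeMeasure n) ∂unif| ≤ D * C := by
        intro t
        rw [integral_integral_swap (integrable_of_abs_le (hm t) fun _ => hBC _ _)]
        have : ∀ x, ∫ s, f (a + s + proj (Fin.tail v) x) * g (b + t + proj (Fin.tail v') x) ∂unif =
            avg f (a + proj (Fin.tail v) x) * g (b + t + proj (Fin.tail v') x) := by
          intro x
          rw [integral_mul_const]
          unfold avg
          congr 2
          ext s
          ring_nf
        simp only [this]
        exact ih _ _ (measurable_avg hf) (abs_avg_le hB) hD a (b + t)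
      have hm3 : ∀ c c' : Bool, Integrable (fun y : ℝ × ℝ =>
          ∫ x, f (a + select c y + proj (Fin.tail v) x) *
            g (b + select c' y + proj (Fin.tail v') x) ∂(cubeMeasure n)) (unif.prod unif) := by
        intro c c'
        have hm2 : Measurable fun p : (ℝ × ℝ) × (Fin n → ℝ × ℝ) =>
            f (a + select c p.1 + proj (Fin.tail v) p.2) *
              g (b + select c' p.1 + proj (Fin.tail v') p.2) :=
          (hf.comp ((measurable_const.add ((measurable_select c).comp measurable_fst)).add
            ((measurable_proj _).comp measurable_snd))).mul
          (hg.comp ((measurable_const.add ((measurable_select c').comp measurable_fst)).add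
            ((measurable_proj _).comp measurable_snd)))
        exact integrable_of_abs_le hm2.stronglyMeasurable.integral_prod_right'.measurable
          fun _ => abs_integral_le_of_abs_le _ fun _ => hBC _ _
      have h3 := hm3 (v 0) (v' 0)
      cases hv0 : v 0 <;> cases hv1 : v' 0 <;> simp only [hv0, hv1, not_true_eq_false] at hv h3 <;>
        simp only [select, Bool.false_eq_true, if_true, if_false] at h3 ⊢
      · rw [integral_prod _ h3]
        exact abs_integral_le_of_abs_le _ key
      · rw [integral_prod_symm _ h3]
        exact abs_integral_le_of_abs_le _ key

theorem sum_pow_hammingDist (ρ : ℝ) : ∀ {n : ℕ} (v : Fin n → Bool),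
    ∑ v' : Fin n → Bool, ρ ^ hammingDist v v' = (1 + ρ) ^ n := by
  intro n v
  have h : ∀ v' : Fin n → Bool,
      ρ ^ hammingDist v v' = ∏ j, (if v j ≠ v' j then ρ else 1) := by
    intro v'
    rw [hammingDist, Finset.card_eq_sum_ones, ← Finset.prod_pow_eq_pow_sum, Finset.prod_filter]
    simp
  simp only [h]
  rw [← Fintype.prod_sum (κ := fun _ : Fin n => Bool) (fun j c => if v j ≠ c then ρ else 1)]
  have : ∀ j, ∑ c : Bool, (if v j ≠ c then ρ else 1) = 1 + ρ := by
    intro j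
    cases v j <;> simp [add_comm]
  rw [Finset.prod_congr rfl fun j _ => this j]
  simp

theorem abs_integral_mul_le_sqrt {α : Type*} [MeasurableSpace α] (μ : Measure α)
    [IsProbabilityMeasure μ] {q F : α → ℝ} (hq : Measurable q) (hF : Measurable F)
    (hq1 : ∀ x, |q x| ≤ 1) {B : ℝ} (hB : ∀ x, |F x| ≤ B) :
    |∫ x, q x * F x ∂μ| ≤ √(∫ x, F x ^ 2 ∂μ) := by
  apply Real.abs_le_sqrt
  set s := ∫ x, q x * F x ∂μ
  have hF2 : Integrable (fun x => F x ^ 2) μ :=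
    integrable_of_abs_le (hF.pow_const 2) (B := B ^ 2) fun x => by
      rw [abs_pow]; exact pow_le_pow_left₀ (abs_nonneg _) (hB x) 2
  have hqF : Integrable (fun x => q x * F x) μ :=
    integrable_of_abs_le (hq.mul hF) (B := 1 * B) fun x => by
      rw [abs_mul]; exact mul_le_mul (hq1 x) (hB x) (abs_nonneg _) zero_le_one
  -- As q² ≤ 1, the integrand dominates (F - s q)²; with s the correlation itself, the integral
  -- equals ∫ F² - s².
  have h : 0 ≤ ∫ x, (F x ^ 2 - 2 * s * (q x * F x) + s ^ 2) ∂μ := by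
    apply integral_nonneg
    intro x
    have h1 : q x ^ 2 ≤ 1 := by
      rw [← sq_abs]; exact pow_le_one₀ (abs_nonneg _) (hq1 x)
    simp only [Pi.zero_apply]
    nlinarith [sq_nonneg (F x - s * q x), mul_nonneg (sq_nonneg s) (sub_nonneg.mpr h1)]
  have h1 := integral_add (hF2.sub (hqF.const_mul (2 * s))) (integrable_const (s ^ 2))
  simp only [Pi.sub_apply] at h1
  rw [h1, integral_sub hF2 (hqF.const_mul _), integral_const_mul] at h
  simp only [integral_const, probReal_univ, one_smul] at h
  linarith

/-- On average over the hidden direction, a bounded query is nearly uncorrelated with a function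
of the hidden projection that becomes small by averaging. -/
theorem sum_abs_integral_mul_proj_le {n : ℕ} {g : ℝ → ℝ} (hg : Measurable g) {B ρ : ℝ}
    (hB : ∀ r z, |avg^[r] g z| ≤ B * ρ ^ r) {q : (Fin n → ℝ × ℝ) → ℝ}
    (hq : Measurable q) (hq1 : ∀ x, |q x| ≤ 1) :
    ∑ v : Fin n → Bool, |∫ x, q x * g (proj v x) ∂(cubeMeasure n)| ≤
      B * √((2 * (1 + ρ)) ^ n) := by
  have hgB : ∀ z, |g z| ≤ B := fun z => by simpa using hB 0 z
  have hB0 : 0 ≤ B := (abs_nonneg _).trans (hgB 0)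
  have hgm : ∀ v : Fin n → Bool, Measurable fun x => g (proj v x) :=
    fun v => hg.comp (measurable_proj v)
  have hsgn : ∀ t : ℝ, |(SignType.sign t : ℝ)| ≤ 1 := by
    intro t
    rcases lt_trichotomy t 0 with h | h | h <;> simp [h]
  let c : (Fin n → Bool) → ℝ := fun v => ∫ x, q x * g (proj v x) ∂(cubeMeasure n)
  -- The signs turn the sum of absolute values into the correlation of `q` with one function, whose
  -- L² norm is a sum of pairwise correlations and so is controlled by `sum_pow_hammingDist`.
  let σ : (Fin n → Bool) → ℝ := fun v => (SignType.sign (c v) : ℝ)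
  have hint : ∀ v : Fin n → Bool, Integrable (fun x => q x * g (proj v x)) (cubeMeasure n) :=
    fun v => integrable_of_abs_le (hq.mul (hgm v)) (B := 1 * B) fun x => by
      rw [abs_mul]; exact mul_le_mul (hq1 x) (hgB _) (abs_nonneg _) zero_le_one
  have h1 : ∑ v, |c v| = ∫ x, q x * ∑ v, σ v * g (proj v x) ∂(cubeMeasure n) := by
    simp only [Finset.mul_sum]
    rw [integral_finsetSum]
    · apply Finset.sum_congr rfl
      intro v _
      rw [← sign_mul_self (c v), ← integral_const_mul]
      congr 1
      ext x
      ring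
    · intro v _
      refine ((hint v).const_mul (σ v)).congr (Eventually.of_forall fun x => ?_)
      simp only
      ring
  have hσ : ∀ v, |σ v| ≤ 1 := fun v => hsgn _
  have hFm : Measurable fun x => ∑ v, σ v * g (proj v x) :=
    Finset.measurable_sum _ fun v _ => (hgm v).const_mul _
  have hFb : ∀ x, |∑ v, σ v * g (proj v x)| ≤ ∑ v : Fin n → Bool, 1 * B := by
    intro x
    refine (Finset.abs_sum_le_sum_abs _ _).trans (Finset.sum_le_sum fun v _ => ?_)
    rw [abs_mul]
    exact mul_le_mul (hσ v) (hgB _) (abs_nonneg _) zero_le_one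
  have h2 := abs_integral_mul_le_sqrt (cubeMeasure n) hq hFm hq1 hFb
  have h3 : ∫ x, (∑ v, σ v * g (proj v x)) ^ 2 ∂(cubeMeasure n) ≤
      B ^ 2 * (2 * (1 + ρ)) ^ n := by
    have hgg : ∀ v v' : Fin n → Bool,
        Integrable (fun x => g (proj v x) * g (proj v' x)) (cubeMeasure n) :=
      fun v v' => integrable_of_abs_le ((hgm v).mul (hgm v')) (B := B * B) fun x => by
        rw [abs_mul]; exact mul_le_mul (hgB _) (hgB _) (abs_nonneg _) hB0
    calc ∫ x, (∑ v, σ v * g (proj v x)) ^ 2 ∂(cubeMeasure n)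
        = ∫ x, ∑ v, ∑ v', (σ v * σ v') * (g (proj v x) * g (proj v' x)) ∂(cubeMeasure n) := by
          congr 1
          ext x
          rw [sq, Finset.sum_mul_sum]
          refine Finset.sum_congr rfl fun v _ => Finset.sum_congr rfl fun v' _ => ?_
          ring
      _ = ∑ v, ∑ v', (σ v * σ v') * ∫ x, g (proj v x) * g (proj v' x) ∂(cubeMeasure n) := by
          rw [integral_finsetSum _ fun v _ =>
            integrable_finsetSum _ fun v' _ => (hgg v v').const_mul _]
          refine Finset.sum_congr rfl fun v _ => ?_
          rw [integral_finsetSum _ fun v' _ => (hgg v v').const_mul _]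
          refine Finset.sum_congr rfl fun v' _ => ?_
          rw [integral_const_mul]
      _ ≤ ∑ v : Fin n → Bool, ∑ v' : Fin n → Bool, B ^ 2 * ρ ^ hammingDist v v' := by
          refine Finset.sum_le_sum fun v _ => Finset.sum_le_sum fun v' _ => ?_
          have h4 := abs_integral_proj_mul_proj_le v v' hg hg hgB hgB
            (hB (hammingDist v v')) 0 0
          simp only [zero_add] at h4
          refine (le_abs_self _).trans ?_
          rw [abs_mul, abs_mul]
          calc _ ≤ 1 * 1 * (B * ρ ^ hammingDist v v' * B) := by
                gcongr <;> exact hσ _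
            _ = _ := by ring
      _ = B ^ 2 * (2 * (1 + ρ)) ^ n := by
          simp only [← Finset.mul_sum, sum_pow_hammingDist]
          simp [mul_pow]
  calc ∑ v, |c v| = ∫ x, q x * ∑ v, σ v * g (proj v x) ∂(cubeMeasure n) := h1
    _ ≤ _ := le_abs_self _
    _ ≤ _ := h2
    _ ≤ √(B ^ 2 * (2 * (1 + ρ)) ^ n) := Real.sqrt_le_sqrt h3
    _ = _ := by rw [Real.sqrt_mul (sq_nonneg B), Real.sqrt_sq hB0]

end Correlation

/-! ### Cells, pieces and the majority label -/

section SignPattern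

variable {ε : ℝ}

theorem floor_eq_floor_two_mul_div (y : ℝ) : ⌊y⌋ = ⌊2 * y⌋ / 2 := by
  rw [Int.floor_eq_iff]
  have h1 := Int.floor_le (2 * y)
  have h2 := Int.lt_floor_add_one (2 * y)
  set m := ⌊2 * y⌋
  have h3 : (2 * (m / 2 : ℤ) : ℝ) ≤ m := by exact_mod_cast (by omega : 2 * (m / 2) ≤ m)
  have h4 : (m : ℝ) ≤ 2 * (m / 2 : ℤ) + 1 := by exact_mod_cast (by omega : m ≤ 2 * (m / 2) + 1)
  constructor <;> linarith

/-- The number of the cell of `ℤ / 2 + 1 / 4` that contains `w`. -/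
def cell (w : ℝ) : ℤ := ⌊2 * w - 1 / 2⌋

/-- Moving up into an even cell crosses a point of ℤ + 1/4, and moving up into an odd cell crosses a
point of ℤ - 1/4. Both counts are therefore functions of the two cell numbers, which reduces the
comparison of labels to integer arithmetic. -/
theorem combCount_neg_quarter (z : ℝ) :
    combCount ε (-(1 / 4)) z = cell ((1 + ε) * z) / 2 - cell z / 2 := by
  unfold combCount cell
  rw [floor_eq_floor_two_mul_div (_ + -(1 / 4)), floor_eq_floor_two_mul_div (z + -(1 / 4))]
  congr 3 <;> ring

theorem combCount_quarter (z : ℝ) :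
    combCount ε (1 / 4) z = (cell ((1 + ε) * z) + 1) / 2 - (cell z + 1) / 2 := by
  unfold combCount cell
  rw [floor_eq_floor_two_mul_div (_ + 1 / 4), floor_eq_floor_two_mul_div (z + 1 / 4),
    ← Int.floor_add_one, ← Int.floor_add_one]
  congr 3 <;> ring

theorem cell_mono {w w' : ℝ} (h : w ≤ w') : cell w ≤ cell w' :=
  Int.floor_le_floor (by linarith)

theorem cell_eq_iff_lt {w : ℝ} (hw : ∀ k : ℤ, w ≠ k / 2 + 1 / 4) (p : ℤ) :
    cell w = p ↔ (p / 2 + 1 / 4 < w ∧ w < (p + 1) / 2 + 1 / 4 : Prop) := by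
  unfold cell
  rw [Int.floor_eq_iff]
  constructor
  · rintro ⟨h1, h2⟩
    refine ⟨lt_of_le_of_ne (by linarith) (hw p).symm, by linarith⟩
  · rintro ⟨h1, h2⟩
    constructor <;> linarith

/-- The left endpoint of the piece on which `z` is in cell `p` and `(1 + ε) z` in cell `s`. -/
def pieceLo (ε : ℝ) (p s : ℤ) : ℝ := max (p / 2 + 1 / 4) ((s / 2 + 1 / 4) / (1 + ε))

/-- The right endpoint of the piece on which `z` is in cell `p` and `(1 + ε) z` in cell `s`. -/
def pieceHi (ε : ℝ) (p s : ℤ) : ℝ :=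
  max (pieceLo ε p s) (min ((p + 1) / 2 + 1 / 4) (((s + 1) / 2 + 1 / 4) / (1 + ε)))

theorem pieceLo_mem (hε : 0 < ε) (p s : ℤ) : pieceLo ε p s ∈ breakpoints ε := by
  unfold pieceLo
  rcases max_choice (p / 2 + 1 / 4 : ℝ) ((s / 2 + 1 / 4) / (1 + ε)) with h | h <;> rw [h]
  · exact ⟨p, Or.inl rfl⟩
  · exact ⟨s, Or.inr (by field_simp)⟩

theorem pieceHi_mem (hε : 0 < ε) (p s : ℤ) : pieceHi ε p s ∈ breakpoints ε := by
  unfold pieceHi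
  rcases max_choice (pieceLo ε p s)
    (min ((p + 1) / 2 + 1 / 4) (((s + 1) / 2 + 1 / 4) / (1 + ε))) with h | h <;> rw [h]
  · exact pieceLo_mem hε p s
  · rcases min_choice ((p + 1) / 2 + 1 / 4 : ℝ) (((s + 1) / 2 + 1 / 4) / (1 + ε)) with h | h <;>
      rw [h]
    · exact ⟨p + 1, Or.inl (by push_cast; rfl)⟩
    · exact ⟨s + 1, Or.inr (by push_cast; field_simp)⟩

theorem mem_piece_iff (hε : 0 < ε) {z : ℝ} (hz : z ∉ breakpoints ε) (p s : ℤ) :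
    (pieceLo ε p s < z ∧ z < pieceHi ε p s) ↔ (cell z = p ∧ cell ((1 + ε) * z) = s) := by
  have h1 : ∀ k : ℤ, z ≠ k / 2 + 1 / 4 := fun k h => hz ⟨k, Or.inl h⟩
  have h2 : ∀ k : ℤ, (1 + ε) * z ≠ k / 2 + 1 / 4 := fun k h => hz ⟨k, Or.inr h⟩
  have h0 : 0 < 1 + ε := by linarith
  rw [cell_eq_iff_lt h1, cell_eq_iff_lt h2]
  unfold pieceHi
  rw [lt_max_iff, lt_min_iff]
  have e : (pieceLo ε p s < z) ↔
      (p / 2 + 1 / 4 < z ∧ s / 2 + 1 / 4 < (1 + ε) * z : Prop) := by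
    unfold pieceLo
    rw [max_lt_iff, div_lt_iff₀ h0, mul_comm z]
  have e2 : z < ((s + 1) / 2 + 1 / 4) / (1 + ε) ↔ (1 + ε) * z < (s + 1) / 2 + 1 / 4 := by
    rw [lt_div_iff₀ h0, mul_comm z]
  constructor
  · rintro ⟨h3, h4 | ⟨h4, h5⟩⟩
    · exact absurd h3 (not_lt.mpr h4.le)
    · exact ⟨⟨(e.mp h3).1, h4⟩, ⟨(e.mp h3).2, e2.mp h5⟩⟩
  · rintro ⟨⟨h3, h4⟩, ⟨h5, h6⟩⟩
    exact ⟨e.mpr ⟨h3, h5⟩, Or.inr ⟨h4, e2.mpr h6⟩⟩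

/-- The outer maximum in `pieceHi` collapses an empty piece to a point, so its factor is a square
and positive away from breakpoints. -/
theorem piece_factor_neg_iff (hε : 0 < ε) {z : ℝ} (hz : z ∉ breakpoints ε) (p s : ℤ) :
    ((z - pieceLo ε p s) * (z - pieceHi ε p s) < 0 ↔
      (cell z = p ∧ cell ((1 + ε) * z) = s)) ∧
    (¬ (cell z = p ∧ cell ((1 + ε) * z) = s) →
      0 < (z - pieceLo ε p s) * (z - pieceHi ε p s)) := by
  have hle : pieceLo ε p s ≤ pieceHi ε p s := le_max_left _ _
  have hlo : z ≠ pieceLo ε p s := fun h => hz (h ▸ pieceLo_mem hε p s)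
  have hhi : z ≠ pieceHi ε p s := fun h => hz (h ▸ pieceHi_mem hε p s)
  rw [← mem_piece_iff hε hz]
  rcases lt_or_gt_of_ne hlo with h1 | h1
  · have : 0 < (z - pieceLo ε p s) * (z - pieceHi ε p s) :=
      mul_pos_of_neg_of_neg (by linarith) (by linarith)
    exact ⟨⟨fun h => absurd h (not_lt.mpr this.le), fun h => absurd h.1 (not_lt.mpr h1.le)⟩,
      fun _ => this⟩
  · rcases lt_or_gt_of_ne hhi with h2 | h2
    · have : (z - pieceLo ε p s) * (z - pieceHi ε p s) < 0 :=
        mul_neg_of_pos_of_neg (by linarith) (by linarith)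
      exact ⟨⟨fun _ => ⟨h1, h2⟩, fun _ => this⟩, fun h => absurd ⟨h1, h2⟩ h⟩
    · have : 0 < (z - pieceLo ε p s) * (z - pieceHi ε p s) :=
        mul_pos (by linarith) (by linarith)
      exact ⟨⟨fun h => absurd h (not_lt.mpr this.le), fun h => absurd h.2 (not_lt.mpr h2.le)⟩,
        fun _ => this⟩

/-- The polynomial that is negative precisely on the union of a finite set of pieces. -/
theorem prod_pieces_neg_iff (hε : 0 < ε) {z : ℝ} (hz : z ∉ breakpoints ε) {ι : Type} [Fintype ι]
    {c : ι → ℤ × ℤ} (hc : Function.Injective c) :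
    (∏ i, (z - pieceLo ε (c i).1 (c i).2) * (z - pieceHi ε (c i).1 (c i).2) < 0) ↔
      ∃ i, c i = (cell z, cell ((1 + ε) * z)) := by
  classical
  have hpos : ∀ i, c i ≠ (cell z, cell ((1 + ε) * z)) →
      0 < (z - pieceLo ε (c i).1 (c i).2) * (z - pieceHi ε (c i).1 (c i).2) := by
    intro i hi
    apply (piece_factor_neg_iff hε hz _ _).2
    rintro ⟨h1, h2⟩
    exact hi (Prod.ext h1.symm h2.symm)
  constructor
  · intro h
    by_contra hne
    push Not at hne
    exact absurd h (not_lt.mpr (Finset.prod_pos fun i _ => hpos i (hne i)).le)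
  · rintro ⟨i, hi⟩
    rw [← Finset.mul_prod_erase _ _ (Finset.mem_univ i)]
    apply mul_neg_of_neg_of_pos
    · rw [(piece_factor_neg_iff hε hz _ _).1, hi]
      exact ⟨rfl, rfl⟩
    · refine Finset.prod_pos fun j hj => hpos j fun h => ?_
      exact (Finset.ne_of_mem_erase hj) (hc (h.trans hi.symm))

/-- The pieces with negative label: the second component ranges over `[-R, R]`. -/
def negPiece (R J : ℕ) (i : Bool × Fin (2 * R + 1) × Fin J) : ℤ × ℤ :=
  -- The first component `true` is for z > 0: from an even cell up to an odd one, with A = i.2.2 and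
  -- B = A + 1 ≤ J. The value `false` is the mirror image for z < 0.
  let k : ℤ := (i.2.1 : ℤ) - R
  if i.1 then (2 * k, 2 * k + 1 + 2 * (i.2.2 : ℤ)) else (2 * k + 1 + 2 * (i.2.2 : ℤ), 2 * k)

theorem negPiece_injective (R J : ℕ) : Function.Injective (negPiece R J) := by
  rintro ⟨a, ⟨k, hk⟩, ⟨i, hi⟩⟩ ⟨a', ⟨k', hk'⟩, ⟨i', hi'⟩⟩ h
  unfold negPiece at h
  cases a <;> cases a' <;> simp at h ⊢ <;> omega

/-- The counts of the two combs are determined by the cells. -/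
theorem counts_of_not_negPiece {R J : ℕ} {p s : ℤ} (h : p ≤ s)
    (hR : s - p ≤ 2 * J - 1 → -(R : ℤ) ≤ p / 2 ∧ p / 2 ≤ R)
    (hn : ¬ ∃ i, negPiece R J i = (p, s)) :
    (s + 1) / 2 - (p + 1) / 2 ≤ s / 2 - p / 2 ∨
      ((s + 1) / 2 - (p + 1) / 2 = s / 2 - p / 2 + 1 ∧
        (J : ℤ) + 1 ≤ (s + 1) / 2 - (p + 1) / 2) := by
  by_contra hcon
  push Not at hcon
  have h1 := hcon.2 (by omega)
  obtain ⟨h2, h3⟩ := hR (by omega)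
  refine hn ⟨(true, ⟨(p / 2 + R).toNat, by omega⟩, ⟨(s / 2 - p / 2).toNat, by omega⟩), ?_⟩
  simp only [negPiece, if_true, Prod.mk.injEq]
  omega

theorem counts_of_not_negPiece' {R J : ℕ} {p s : ℤ} (h : s ≤ p)
    (hR : p - s ≤ 2 * J - 1 → -(R : ℤ) ≤ s / 2 ∧ s / 2 ≤ R)
    (hn : ¬ ∃ i, negPiece R J i = (p, s)) :
    (p + 1) / 2 - (s + 1) / 2 ≤ p / 2 - s / 2 ∨
      ((p + 1) / 2 - (s + 1) / 2 = p / 2 - s / 2 + 1 ∧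
        (J : ℤ) + 1 ≤ (p + 1) / 2 - (s + 1) / 2) := by
  by_contra hcon
  push Not at hcon
  have h1 := hcon.2 (by omega)
  obtain ⟨h2, h3⟩ := hR (by omega)
  refine hn ⟨(false, ⟨(s / 2 + R).toNat, by omega⟩, ⟨(p / 2 - s / 2).toNat, by omega⟩), ?_⟩
  simp only [negPiece, Bool.false_eq_true, if_false, Prod.mk.injEq]
  omega

theorem counts_of_negPiece {R J : ℕ} {p s : ℤ} (hn : ∃ i, negPiece R J i = (p, s)) :
    (p < s ∧ (s + 1) / 2 - (p + 1) / 2 = s / 2 - p / 2 + 1 ∧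
      (s + 1) / 2 - (p + 1) / 2 ≤ J) ∨
    (s < p ∧ (p + 1) / 2 - (s + 1) / 2 = p / 2 - s / 2 + 1 ∧
      (p + 1) / 2 - (s + 1) / 2 ≤ J) := by
  obtain ⟨⟨a, ⟨k, hk⟩, ⟨i, hi⟩⟩, h⟩ := hn
  cases a <;> simp [negPiece] at h <;> omega

/-- The counts `A`, `B` of positive and negative comb points agree with the label `+1`. -/
theorem massart_pos {J : ℕ} (hJ : 1 ≤ J) {A B : ℝ} (hB : 0 ≤ B)
    (h : B ≤ A ∨ (B = A + 1 ∧ (J : ℝ) + 1 ≤ B)) :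
    (1 - 2 / (2 * (J : ℝ) + 1)) * B ≤
      (1 - 1 / (2 * (J : ℝ) + 2) ^ 2) / 2 * (A + (1 - 2 / (2 * (J : ℝ) + 1)) * B) := by
  have hJ' : (1 : ℝ) ≤ J := by exact_mod_cast hJ
  set j : ℝ := (J : ℝ)
  have e1 : 1 - 2 / (2 * j + 1) = (2 * j - 1) / (2 * j + 1) := by field_simp; ring
  have e2 : (1 - 1 / (2 * j + 2) ^ 2) / 2 = ((2 * j + 1) * (2 * j + 3)) / (2 * (2 * j + 2) ^ 2) := by
    field_simp; ring
  rw [e1, e2, div_mul_eq_mul_div, div_mul_eq_mul_div, ← sub_nonneg]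
  have : (2 * j + 1) * (2 * j + 3) * (A + (2 * j - 1) * B / (2 * j + 1)) / (2 * (2 * j + 2) ^ 2) -
      (2 * j - 1) * B / (2 * j + 1) =
      ((2 * j + 1) * (2 * j + 3) * ((2 * j + 1) * A + (2 * j - 1) * B) -
        (2 * (2 * j + 2) ^ 2) * ((2 * j - 1) * B)) / ((2 * (2 * j + 2) ^ 2) * (2 * j + 1)) := by
    field_simp
  rw [this]
  apply div_nonneg _ (by positivity)
  -- In the second case B/A = 1 + 1/A is worst at B = J + 1, where βB = J - 1/(2J + 1) is still
  -- below A = J.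
  rcases h with h | ⟨h, h'⟩
  · have h1 : (2 * j + 1) * (2 * j + 3) * ((2 * j + 1) * B) ≤
        (2 * j + 1) * (2 * j + 3) * ((2 * j + 1) * A) := by gcongr
    nlinarith [mul_nonneg hB (by positivity : 0 ≤ j), mul_nonneg hB (by positivity : 0 ≤ j ^ 2)]
  · obtain rfl : A = B - 1 := by linarith
    obtain ⟨t, rfl⟩ : ∃ t, B = j + 1 + t := ⟨B - j - 1, by ring⟩
    have ht : 0 ≤ t := by linarith
    nlinarith [mul_nonneg ht (by positivity : 0 ≤ j), mul_nonneg ht (by positivity : 0 ≤ j ^ 2),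
      mul_nonneg ht (by positivity : 0 ≤ j ^ 3)]

/-- The counts `A`, `B` of positive and negative comb points agree with the label `-1`. -/
theorem massart_neg {J : ℕ} (hJ : 1 ≤ J) {A B : ℝ} (hA : 0 ≤ A) (h : B = A + 1) (h' : B ≤ J) :
    A ≤ (1 - 1 / (2 * (J : ℝ) + 2) ^ 2) / 2 * (A + (1 - 2 / (2 * (J : ℝ) + 1)) * B) := by
  have hJ' : (1 : ℝ) ≤ J := by exact_mod_cast hJ
  set j : ℝ := (J : ℝ)
  have e1 : 1 - 2 / (2 * j + 1) = (2 * j - 1) / (2 * j + 1) := by field_simp; ring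
  have e2 : (1 - 1 / (2 * j + 2) ^ 2) / 2 = ((2 * j + 1) * (2 * j + 3)) / (2 * (2 * j + 2) ^ 2) := by
    field_simp; ring
  rw [e1, e2, ← sub_nonneg]
  have : (2 * j + 1) * (2 * j + 3) / (2 * (2 * j + 2) ^ 2) * (A + (2 * j - 1) / (2 * j + 1) * B) -
      A = ((2 * j + 1) * (2 * j + 3) * ((2 * j + 1) * A + (2 * j - 1) * B) -
        (2 * (2 * j + 2) ^ 2) * ((2 * j + 1) * A)) / ((2 * (2 * j + 2) ^ 2) * (2 * j + 1)) := by
    field_simp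
  rw [this]
  apply div_nonneg _ (by positivity)
  -- The worst case is t = 0, that is B = J, where βB = J - 1 + 1/(2J + 1) just exceeds A = J - 1.
  obtain ⟨t, ht⟩ : ∃ t, j = A + 1 + t := ⟨j - A - 1, by ring⟩
  have ht0 : 0 ≤ t := by linarith
  subst h
  rw [ht]
  ring_nf
  positivity

end SignPattern

/-! ### Labelled densities and the threshold polynomial -/

section LabelledDensities

/-- The (unnormalized) density of the positive examples along the hidden direction. -/
def posDensity (ε : ℝ) (z : ℝ) : ℝ := combDensity ε (-(1 / 4)) z

/-- The (unnormalized) density of the negative examples along the hidden direction. -/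
def negDensity (ε : ℝ) (J : ℕ) (z : ℝ) : ℝ :=
  (1 - 2 / (2 * (J : ℝ) + 1)) * combDensity ε (1 / 4) z

/-- The density of the examples that are misclassified by the sign of the polynomial with
roots `r`. -/
def errDensity (ε : ℝ) (J : ℕ) {ι : Type} [Fintype ι] (r : ι → ℝ) (z : ℝ) : ℝ :=
  if 0 ≤ ∏ i, (z - r i) then negDensity ε J z else posDensity ε z

variable {ε : ℝ} {J : ℕ}

theorem bias_mem (hJ : 1 ≤ J) :
    0 < 1 - 2 / (2 * (J : ℝ) + 1) ∧ 1 - 2 / (2 * (J : ℝ) + 1) ≤ 1 := by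
  have hJ' : (1 : ℝ) ≤ J := by exact_mod_cast hJ
  constructor
  · rw [sub_pos, div_lt_one (by positivity)]
    linarith
  · have : 0 ≤ 2 / (2 * (J : ℝ) + 1) := by positivity
    linarith

theorem posDensity_nonneg (hε : 0 < ε) (z : ℝ) : 0 ≤ posDensity ε z := combDensity_nonneg hε _ z

theorem negDensity_nonneg (hε : 0 < ε) (hJ : 1 ≤ J) (z : ℝ) : 0 ≤ negDensity ε J z :=
  mul_nonneg (bias_mem hJ).1.le (combDensity_nonneg hε _ z)

theorem abs_posDensity_le (hε : 0 < ε) (hε' : ε ≤ 1 / 2) (z : ℝ) : |posDensity ε z| ≤ 7 / ε := by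
  rw [abs_of_nonneg (posDensity_nonneg hε z)]
  exact combDensity_le hε hε' (Or.inr rfl) z

theorem abs_negDensity_le (hε : 0 < ε) (hε' : ε ≤ 1 / 2) (hJ : 1 ≤ J) (z : ℝ) :
    |negDensity ε J z| ≤ 7 / ε := by
  rw [abs_of_nonneg (negDensity_nonneg hε hJ z)]
  exact (mul_le_of_le_one_left (combDensity_nonneg hε _ z) (bias_mem hJ).2).trans
    (combDensity_le hε hε' (Or.inl rfl) z)

theorem measurable_posDensity (hε : 0 < ε) : Measurable (posDensity ε) :=
  measurable_combDensity hε _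

theorem measurable_negDensity (hε : 0 < ε) (J : ℕ) : Measurable (negDensity ε J) :=
  (measurable_combDensity hε _).const_mul _

section Err
variable {ι : Type} [Fintype ι] (r : ι → ℝ)

theorem measurable_errDensity (hε : 0 < ε) (J : ℕ) : Measurable (errDensity ε J r) := by
  apply Measurable.ite
  · apply measurableSet_le measurable_const
    exact Finset.measurable_prod _ fun i _ => by fun_prop
  · exact measurable_negDensity hε J
  · exact measurable_posDensity hε

theorem errDensity_nonneg (hε : 0 < ε) (hJ : 1 ≤ J) (z : ℝ) : 0 ≤ errDensity ε J r z := by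
  unfold errDensity
  split_ifs
  · exact negDensity_nonneg hε hJ z
  · exact posDensity_nonneg hε z

/-- Outside the bulk the density is at most 1 + 1/(ε · 1/(2ε)) = 3, independently of ε. This turns
the tail probability into a bound on the error. -/
theorem errDensity_le_three (hε : 0 < ε) (hJ : 1 ≤ J) {z : ℝ} (hz : 1 / (2 * ε) ≤ |z|) :
    errDensity ε J r z ≤ 3 := by
  have h : ∀ a, combDensity ε a z ≤ 3 := by
    intro a
    refine (combDensity_le_of_le_abs hε (by positivity) hz).trans (le_of_eq ?_)
    field_simp
    norm_num
  unfold errDensity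
  split_ifs
  · exact (mul_le_of_le_one_left (combDensity_nonneg hε _ z) (bias_mem hJ).2).trans (h _)
  · exact h _

end Err

theorem cell_sub_cell (ε z : ℝ) :
    (cell ((1 + ε) * z) - cell z : ℝ) < 2 * ε * z + 1 ∧
      2 * ε * z - 1 < (cell ((1 + ε) * z) - cell z : ℝ) := by
  unfold cell
  have h1 := Int.floor_le (2 * ((1 + ε) * z) - 1 / 2)
  have h2 := Int.lt_floor_add_one (2 * ((1 + ε) * z) - 1 / 2)
  have h3 := Int.floor_le (2 * z - 1 / 2)
  have h4 := Int.lt_floor_add_one (2 * z - 1 / 2)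
  constructor <;> nlinarith

theorem div_two_bounds (m : ℤ) : ((m / 2 : ℤ) : ℝ) ≤ m / 2 ∧ (m : ℝ) / 2 ≤ (m / 2 : ℤ) + 1 / 2 := by
  have h1 : (2 * (m / 2 : ℤ) : ℝ) ≤ m := by exact_mod_cast (by omega : 2 * (m / 2) ≤ m)
  have h2 : (m : ℝ) ≤ 2 * (m / 2 : ℤ) + 1 := by exact_mod_cast (by omega : m ≤ 2 * (m / 2) + 1)
  constructor <;> linarith

/-- The number of pieces on which the label is negative is `O(J² / ε)`. -/
theorem cell_range (hε : 0 < ε) (hε' : ε ≤ 1 / 2) (hJ : 1 ≤ J) {z : ℝ} :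
    (0 < z → cell ((1 + ε) * z) - cell z ≤ 2 * J - 1 →
      -(⌈2 * J / ε⌉₊ : ℤ) ≤ cell z / 2 ∧ cell z / 2 ≤ ⌈2 * J / ε⌉₊) ∧
    (z < 0 → cell z - cell ((1 + ε) * z) ≤ 2 * J - 1 →
      -(⌈2 * J / ε⌉₊ : ℤ) ≤ cell ((1 + ε) * z) / 2 ∧
        cell ((1 + ε) * z) / 2 ≤ ⌈2 * J / ε⌉₊) := by
  have hJ' : (1 : ℝ) ≤ J := by exact_mod_cast hJ
  have hR := Nat.le_ceil (2 * J / ε)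
  set R := ⌈2 * J / ε⌉₊
  obtain ⟨h1, h2⟩ := cell_sub_cell ε z
  have h5 : 2 ≤ (J : ℝ) / ε := by
    rw [le_div_iff₀ hε]; linarith
  have e : 2 * J / ε = 2 * (J / ε) := by ring
  rw [e] at hR
  have h3 := Int.floor_le (2 * ((1 + ε) * z) - 1 / 2)
  have h4 := Int.lt_floor_add_one (2 * ((1 + ε) * z) - 1 / 2)
  have h6 := Int.floor_le (2 * z - 1 / 2)
  have h7 := Int.lt_floor_add_one (2 * z - 1 / 2)
  change ((cell ((1 + ε) * z) : ℤ) : ℝ) ≤ _ at h3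
  change _ < ((cell ((1 + ε) * z) : ℤ) : ℝ) + 1 at h4
  change ((cell z : ℤ) : ℝ) ≤ _ at h6
  change _ < ((cell z : ℤ) : ℝ) + 1 at h7
  obtain ⟨d1, d2⟩ := div_two_bounds (cell z)
  obtain ⟨d3, d4⟩ := div_two_bounds (cell ((1 + ε) * z))
  constructor
  · intro hz hs
    have hs' : (cell ((1 + ε) * z) - cell z : ℝ) ≤ 2 * J - 1 := by exact_mod_cast hs
    -- At z about 2εz cell boundaries are crossed, so at most 2J - 1 crossings confine z to a range
    -- of length O(J/ε).
    have hz' : z < J / ε := by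
      rw [lt_div_iff₀ hε]
      linarith
    constructor
    · have : (-(R : ℝ)) ≤ (cell z / 2 : ℤ) := by linarith
      exact_mod_cast this
    · have : ((cell z / 2 : ℤ) : ℝ) ≤ R := by linarith
      exact_mod_cast this
  · intro hz hs
    have hs' : (cell z - cell ((1 + ε) * z) : ℝ) ≤ 2 * J - 1 := by exact_mod_cast hs
    have hz' : -z < J / ε := by
      rw [lt_div_iff₀ hε]
      linarith
    have hz2 : 3 / 2 * z ≤ (1 + ε) * z := by nlinarith
    have hz3 : (1 + ε) * z ≤ 0 := by nlinarith
    constructor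
    · have : (-(R : ℝ)) < (cell ((1 + ε) * z) / 2 : ℤ) + 1 := by linarith
      exact Int.lt_add_one_iff.mp (by exact_mod_cast this)
    · have : ((cell ((1 + ε) * z) / 2 : ℤ) : ℝ) ≤ R := by linarith
      exact_mod_cast this

/-- The labels are those of a polynomial threshold function of degree `O(J² / ε)` along the hidden
direction, up to Massart noise which vanishes in the bulk `|z| < 1 / (2 ε)`. -/
theorem exists_roots (hε : 0 < ε) (hε' : ε ≤ 1 / 2) (hJ : 1 ≤ J) :
    ∃ (ι : Type) (_ : Fintype ι) (r : ι → ℝ), 1 ≤ Fintype.card ι ∧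
      (Fintype.card ι : ℝ) ≤ 24 * J ^ 2 / ε ∧
      ∀ z, errDensity ε J r z ≤
          (1 - 1 / (2 * (J : ℝ) + 2) ^ 2) / 2 * (posDensity ε z + negDensity ε J z) ∧
        (|z| < 1 / (2 * ε) → errDensity ε J r z = 0) := by
  have hJ' : (1 : ℝ) ≤ J := by exact_mod_cast hJ
  set R := ⌈2 * J / ε⌉₊ with hRdef
  -- Two roots per negative piece, its endpoints: 4J(2R + 1) roots in total.
  let r : (Bool × Fin (2 * R + 1) × Fin J) × Bool → ℝ := fun i =>
    if i.2 then pieceLo ε (negPiece R J i.1).1 (negPiece R J i.1).2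
      else pieceHi ε (negPiece R J i.1).1 (negPiece R J i.1).2
  refine ⟨(Bool × Fin (2 * R + 1) × Fin J) × Bool, inferInstance, r, ?_, ?_, ?_⟩
  · simp only [Fintype.card_prod, Fintype.card_bool, Fintype.card_fin]
    nlinarith [Nat.zero_le (R * J)]
  · simp only [Fintype.card_prod, Fintype.card_bool, Fintype.card_fin]
    push_cast
    have h1 : (R : ℝ) < 2 * J / ε + 1 := Nat.ceil_lt_add_one (by positivity)
    have h5 : 2 ≤ (J : ℝ) / ε := by
      rw [le_div_iff₀ hε]; linarith
    have e : 2 * J / ε = 2 * (J / ε) := by ring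
    have e2 : 24 * (J : ℝ) ^ 2 / ε = 4 * J * (6 * (J / ε)) := by ring
    rw [e] at h1
    rw [e2]
    have : 2 * (R : ℝ) + 1 ≤ 6 * (J / ε) := by linarith
    nlinarith
  intro z
  have hγ : 0 ≤ (1 - 1 / (2 * (J : ℝ) + 2) ^ 2) / 2 := by
    have : 1 / (2 * (J : ℝ) + 2) ^ 2 ≤ 1 := by
      rw [div_le_one (by positivity)]
      nlinarith
    linarith
  by_cases hz : z ∈ breakpoints ε
  · simp [errDensity, posDensity, negDensity, combDensity, hz]
  have hprod : ∏ i, (z - r i) = ∏ i, (z - pieceLo ε (negPiece R J i).1 (negPiece R J i).2) *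
      (z - pieceHi ε (negPiece R J i).1 (negPiece R J i).2) := by
    rw [Fintype.prod_prod_type]
    refine Finset.prod_congr rfl fun i _ => ?_
    simp [r]
  have hneg := prod_pieces_neg_iff hε hz (negPiece_injective R J)
  rw [← hprod] at hneg
  obtain ⟨hr1, hr2⟩ := cell_range hε hε' hJ (z := z)
  rw [← hRdef] at hr1 hr2
  obtain ⟨hd1, hd2⟩ := cell_sub_cell ε z
  -- In the bulk at most one cell boundary is crossed, so A and B are not both nonzero and the
  -- winning label is noise-free.
  have hbulk : |z| < 1 / (2 * ε) → cell ((1 + ε) * z) - cell z ≤ 1 ∧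
      cell z - cell ((1 + ε) * z) ≤ 1 := by
    intro h
    rw [lt_div_iff₀ (by positivity)] at h
    have h1 : 2 * ε * z < 1 := by nlinarith [le_abs_self z]
    have h2 : -1 < 2 * ε * z := by nlinarith [neg_abs_le z]
    have h3 : (cell ((1 + ε) * z) - cell z : ℝ) < 2 := by linarith
    have h4 : (cell z - cell ((1 + ε) * z) : ℝ) < 2 := by linarith
    have h3' : cell ((1 + ε) * z) - cell z < 2 := by exact_mod_cast h3
    have h4' : cell z - cell ((1 + ε) * z) < 2 := by exact_mod_cast h4
    omega
  have hpos : posDensity ε z = (combCount ε (-(1 / 4)) z : ℝ) / (ε * z) := by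
    simp [posDensity, combDensity, hz]
  have hngd : negDensity ε J z =
      (1 - 2 / (2 * (J : ℝ) + 1)) * ((combCount ε (1 / 4) z : ℝ) / (ε * z)) := by
    simp [negDensity, combDensity, hz]
  rcases lt_trichotomy z 0 with hz0 | rfl | hz0
  · have hw : 0 < ε * -z := by nlinarith
    set p := cell z
    set s := cell ((1 + ε) * z)
    have hsp : s ≤ p := cell_mono (by nlinarith)
    obtain ⟨A, hA⟩ : ∃ A : ℕ, (A : ℤ) = p / 2 - s / 2 :=
      ⟨(p / 2 - s / 2).toNat, by omega⟩
    obtain ⟨B, hB⟩ : ∃ B : ℕ, (B : ℤ) = (p + 1) / 2 - (s + 1) / 2 :=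
      ⟨((p + 1) / 2 - (s + 1) / 2).toNat, by omega⟩
    have eA : (combCount ε (-(1 / 4)) z : ℝ) / (ε * z) = A / (ε * -z) := by
      rw [combCount_neg_quarter, show s / 2 - p / 2 = -(A : ℤ) by omega]
      push_cast
      rw [mul_neg, neg_div, div_neg]
    have eB : (combCount ε (1 / 4) z : ℝ) / (ε * z) = B / (ε * -z) := by
      rw [combCount_quarter, show (s + 1) / 2 - (p + 1) / 2 = -(B : ℤ) by omega]
      push_cast
      rw [mul_neg, neg_div, div_neg]
    rw [eA] at hpos
    rw [eB] at hngd
    unfold errDensity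
    by_cases hn : ∃ i, negPiece R J i = (p, s)
    · rw [if_neg (not_le.mpr (hneg.mpr hn)), hpos, hngd]
      have h1 : (B : ℤ) = A + 1 ∧ (B : ℤ) ≤ J := by
        rcases counts_of_negPiece hn with h | h <;> omega
      constructor
      · have := massart_neg hJ (A := A) (B := B) (by positivity) (by exact_mod_cast h1.1)
          (by exact_mod_cast h1.2)
        have := div_le_div_of_nonneg_right this hw.le
        refine this.trans (le_of_eq ?_)
        ring
      · intro hb
        have := hbulk hb
        have hA0 : A = 0 := by omega
        simp [hA0]
    · rw [if_pos (not_lt.mp (fun h => hn (hneg.mp h))), hpos, hngd]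
      have h1 := counts_of_not_negPiece' hsp (hr2 hz0) hn
      rw [← hA, ← hB] at h1
      constructor
      · have := massart_pos hJ (A := A) (B := B) (by positivity) (by exact_mod_cast h1)
        have := div_le_div_of_nonneg_right this hw.le
        refine le_trans (le_of_eq ?_) (this.trans (le_of_eq ?_)) <;> ring
      · intro hb
        have := hbulk hb
        have hB0 : B = 0 := by omega
        simp [hB0]
  · simp [hpos, hngd, errDensity]
  · have hw : 0 < ε * z := by positivity
    set p := cell z
    set s := cell ((1 + ε) * z)
    have hsp : p ≤ s := cell_mono (by nlinarith)
    obtain ⟨A, hA⟩ : ∃ A : ℕ, (A : ℤ) = s / 2 - p / 2 :=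
      ⟨(s / 2 - p / 2).toNat, by omega⟩
    obtain ⟨B, hB⟩ : ∃ B : ℕ, (B : ℤ) = (s + 1) / 2 - (p + 1) / 2 :=
      ⟨((s + 1) / 2 - (p + 1) / 2).toNat, by omega⟩
    have eA : (combCount ε (-(1 / 4)) z : ℝ) / (ε * z) = A / (ε * z) := by
      rw [combCount_neg_quarter, ← hA]
      push_cast
      rfl
    have eB : (combCount ε (1 / 4) z : ℝ) / (ε * z) = B / (ε * z) := by
      rw [combCount_quarter, ← hB]
      push_cast
      rfl
    rw [eA] at hpos
    rw [eB] at hngd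
    unfold errDensity
    by_cases hn : ∃ i, negPiece R J i = (p, s)
    · rw [if_neg (not_le.mpr (hneg.mpr hn)), hpos, hngd]
      have h1 : (B : ℤ) = A + 1 ∧ (B : ℤ) ≤ J := by
        rcases counts_of_negPiece hn with h | h <;> omega
      constructor
      · have := massart_neg hJ (A := A) (B := B) (by positivity) (by exact_mod_cast h1.1)
          (by exact_mod_cast h1.2)
        have := div_le_div_of_nonneg_right this hw.le
        refine this.trans (le_of_eq ?_)
        ring
      · intro hb
        have := hbulk hb
        have hA0 : A = 0 := by omega
        simp [hA0]
    · rw [if_pos (not_lt.mp (fun h => hn (hneg.mp h))), hpos, hngd]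
      have h1 := counts_of_not_negPiece hsp (hr1 hz0) hn
      rw [← hA, ← hB] at h1
      constructor
      · have := massart_pos hJ (A := A) (B := B) (by positivity) (by exact_mod_cast h1)
        have := div_le_div_of_nonneg_right this hw.le
        refine le_trans (le_of_eq ?_) (this.trans (le_of_eq ?_)) <;> ring
      · intro hb
        have := hbulk hb
        have hB0 : B = 0 := by omega
        simp [hB0]

end LabelledDensities

/-! ### Linearization of products of linear forms -/

section Embedding

/-- The coordinates of `x`, together with the constant `1`. -/
def extCoord {n : ℕ} (x : Fin n → ℝ × ℝ) : Option (Fin n × Bool) → ℝ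
  | none => 1
  | some (j, b) => select b (x j)

/-- Polynomials that are products of linear forms become linear after an embedding. -/
theorem exists_monomial_embedding {n M : ℕ} {ι : Type} [Fintype ι]
    (hM : (2 * n + 1) ^ Fintype.card ι ≤ M) :
    ∃ Φ : (Fin n → ℝ × ℝ) → Dom M, Measurable Φ ∧
      ∀ a : ι → Option (Fin n × Bool) → ℝ, ∃ w : Dom M, ∀ x,
        inner ℝ w (Φ x) = ∏ t, ∑ o, a t o * extCoord x o := by
  classical
  -- The coordinates are words of length d in 2n + 1 letters, not monomials up to reordering, so
  -- expanding the product needs no multinomial bookkeeping. Spare coordinates of ℝ^M are set to 0.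
  have hcard : Fintype.card (ι → Option (Fin n × Bool)) ≤ Fintype.card (Fin M) := by
    simpa [mul_comm n 2] using hM
  obtain ⟨e⟩ := Function.Embedding.nonempty_of_card_le hcard
  have hinner : ∀ f g : (ι → Option (Fin n × Bool)) → ℝ,
      inner ℝ (WithLp.toLp 2 (Function.extend e f 0) : Dom M)
        (WithLp.toLp 2 (Function.extend e g 0)) = ∑ α, f α * g α := by
    intro f g
    simp only [PiLp.inner_apply, RCLike.inner_apply, conj_trivial]
    rw [← Finset.sum_subset (Finset.subset_univ (Finset.univ.map e))]
    · rw [Finset.sum_map]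
      refine Finset.sum_congr rfl fun α _ => ?_
      simp [e.injective.extend_apply, mul_comm]
    · intro i _ hi
      have : ¬ ∃ α, e α = i := by simpa using hi
      simp [Function.extend_apply' _ _ _ this]
  refine ⟨fun x => WithLp.toLp 2 (Function.extend e (fun α => ∏ t, extCoord x (α t)) 0), ?_, ?_⟩
  · apply (WithLp.measurable_toLp 2 (Fin M → ℝ)).comp
    rw [measurable_pi_iff]
    intro i
    by_cases hi : ∃ α, e α = i
    · obtain ⟨α, rfl⟩ := hi
      simp only [e.injective.extend_apply]
      refine Finset.measurable_prod _ fun t _ => ?_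
      rcases α t with _ | ⟨j, b⟩
      · exact measurable_const
      · exact (measurable_select b).comp (measurable_pi_apply j)
    · simp only [Function.extend_apply' _ _ _ hi]
      exact measurable_const
  · intro a
    refine ⟨WithLp.toLp 2 (Function.extend e (fun α => ∏ t, a t (α t)) 0), fun x => ?_⟩
    rw [hinner, Fintype.prod_sum]
    refine Finset.sum_congr rfl fun α _ => ?_
    rw [Finset.prod_mul_distrib]

theorem proj_eq_sum_extCoord {n : ℕ} (v : Fin n → Bool) (x : Fin n → ℝ × ℝ) (r : ℝ) :
    ∑ o : Option (Fin n × Bool), (match o with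
      | none => -r
      | some (j, b) => if v j = b then 1 else 0) * extCoord x o = proj v x - r := by
  rw [Fintype.sum_option, Fintype.sum_prod_type]
  simp only [extCoord, proj]
  have : ∀ j, ∑ b : Bool, (if v j = b then (1 : ℝ) else 0) * select b (x j) =
      select (v j) (x j) := by
    intro j
    cases v j <;> simp
  simp only [this]
  ring

/-- The projection itself must also be a linear functional of the embedded point, because the noise
rate has to be a function on ℝ^M. It is the product of one linear form with constant factors 1. -/
theorem exists_embedding {n M : ℕ} {ι : Type} [Fintype ι] (hι : 1 ≤ Fintype.card ι)
    (hM : (2 * n + 1) ^ Fintype.card ι ≤ M) (r : ι → ℝ) :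
    ∃ Φ : (Fin n → ℝ × ℝ) → Dom M, Measurable Φ ∧ ∀ v : Fin n → Bool,
      (∃ w : Dom M, ∀ x, inner ℝ w (Φ x) = ∏ t, (proj v x - r t)) ∧
      (∃ w : Dom M, ∀ x, inner ℝ w (Φ x) = proj v x) := by
  classical
  obtain ⟨Φ, hΦ, h⟩ := exists_monomial_embedding (n := n) hM
  refine ⟨Φ, hΦ, fun v => ⟨?_, ?_⟩⟩
  · obtain ⟨w, hw⟩ := h fun t o => match o with
      | none => -r t
      | some (j, b) => if v j = b then 1 else 0
    refine ⟨w, fun x => ?_⟩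
    rw [hw]
    exact Finset.prod_congr rfl fun t _ => proj_eq_sum_extCoord v x (r t)
  · obtain ⟨t₀⟩ : Nonempty ι := Fintype.card_pos_iff.mp hι
    obtain ⟨w, hw⟩ := h fun t o => if t = t₀ then (match o with
      | none => -0
      | some (j, b) => if v j = b then 1 else 0) else (match o with
      | none => 1
      | some _ => 0)
    refine ⟨w, fun x => ?_⟩
    rw [hw, ← Finset.mul_prod_erase _ _ (Finset.mem_univ t₀), Finset.prod_eq_one, mul_one]
    · simp only [if_true]
      exact (proj_eq_sum_extCoord v x 0).trans (sub_zero _)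
    · intro t ht
      simp [Finset.ne_of_mem_erase ht, Fintype.sum_option, extCoord]

end Embedding

/-! ### Subgaussian tails of the projections -/

section Tail

open ProbabilityTheory

/-- Hoeffding's lemma on an interval of length 1 gives the parameter (1/2)²; independence then adds
these up to n/4. -/
theorem hasSubgaussianMGF_select (b : Bool) :
    HasSubgaussianMGF (select b) (1 / 4) (unif.prod unif) := by
  have h1 : HasSubgaussianMGF (id : ℝ → ℝ) (1 / 4) unif := by
    have hb : ∀ᵐ x ∂unif, (id x : ℝ) ∈ Set.Icc (-(1 / 2)) (1 / 2) :=
      ae_restrict_of_forall_mem measurableSet_Ioc fun x hx => ⟨hx.1.le, hx.2⟩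
    have h0 : ∫ x, id x ∂unif = 0 := by
      have := avg_eq_intervalIntegral id 0
      simp only [avg, zero_add] at this
      rw [this]
      simp
    have := hasSubgaussianMGF_of_mem_Icc_of_integral_eq_zero measurable_id.aemeasurable hb h0
    convert this using 1
    ext
    norm_num
  cases b
  · exact HasSubgaussianMGF.of_map (X := id) (Y := Prod.snd) measurable_snd.aemeasurable
      (by rw [show (unif.prod unif).map Prod.snd = unif from measurePreserving_snd.map_eq]; exact h1)
  · exact HasSubgaussianMGF.of_map (X := id) (Y := Prod.fst) measurable_fst.aemeasurable
      (by rw [show (unif.prod unif).map Prod.fst = unif from measurePreserving_fst.map_eq]; exact h1)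

theorem hasSubgaussianMGF_proj {n : ℕ} (v : Fin n → Bool) :
    HasSubgaussianMGF (proj v) (n / 4) (cubeMeasure n) := by
  have hind : iIndepFun (fun j (x : Fin n → ℝ × ℝ) => select (v j) (x j)) (cubeMeasure n) :=
    iIndepFun_pi fun j => (measurable_select (v j)).aemeasurable
  have hsub : ∀ j ∈ Finset.univ,
      HasSubgaussianMGF (fun x : Fin n → ℝ × ℝ => select (v j) (x j)) (1 / 4) (cubeMeasure n) := by
    intro j _
    refine HasSubgaussianMGF.of_map (X := select (v j)) (Y := fun x : Fin n → ℝ × ℝ => x j)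
      (measurable_pi_apply j).aemeasurable ?_
    have : (cubeMeasure n).map (fun x => x j) = unif.prod unif :=
      (measurePreserving_eval (fun _ : Fin n => unif.prod unif) j).map_eq
    rw [this]
    exact hasSubgaussianMGF_select _
  have := HasSubgaussianMGF.sum_of_iIndepFun hind hsub
  convert this using 1
  · rfl
  · simp [div_eq_mul_inv]

theorem measure_proj_ge_le {n : ℕ} (v : Fin n → Bool) {t : ℝ} (ht : 0 ≤ t) :
    (cubeMeasure n).real {x | t ≤ |proj v x|} ≤ 2 * Real.exp (-(2 * t ^ 2 / n)) := by
  have h1 := (hasSubgaussianMGF_proj v).measure_ge_le ht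
  have h2 := (hasSubgaussianMGF_proj v).neg.measure_ge_le ht
  have e : -t ^ 2 / (2 * ((n / 4 : NNReal) : ℝ)) = -(2 * t ^ 2 / n) := by
    push_cast
    rcases eq_or_ne (n : ℝ) 0 with h | h
    · simp [h]
    · field_simp
      ring
  rw [e] at h1 h2
  have hsub : {x | t ≤ |proj v x|} ⊆ {x | t ≤ proj v x} ∪ {x | t ≤ (-proj v) x} := by
    intro x hx
    rcases le_abs.mp (show t ≤ |proj v x| from hx) with h | h
    · exact Or.inl h
    · exact Or.inr h
  calc _ ≤ _ := measureReal_mono hsub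
    _ ≤ _ := measureReal_union_le _ _
    _ ≤ _ := add_le_add h1 h2
    _ = _ := by ring

end Tail

/-! ### Expectations under noisy labels -/

section NoisyLaw

theorem isFiniteMeasure_withDensity_of_le {α : Type*} [MeasurableSpace α] (μ : Measure α)
    [IsFiniteMeasure μ] {p : α → ℝ} {B : ℝ} (hp : ∀ x, p x ≤ B) :
    IsFiniteMeasure (μ.withDensity fun x => ENNReal.ofReal (p x)) := by
  refine isFiniteMeasure_withDensity (ne_of_lt ?_)
  calc ∫⁻ x, ENNReal.ofReal (p x) ∂μ ≤ ∫⁻ _, ENNReal.ofReal B ∂μ :=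
        lintegral_mono fun x => ENNReal.ofReal_le_ofReal (hp x)
    _ < ⊤ := by
        rw [lintegral_const]
        exact ENNReal.mul_lt_top ENNReal.ofReal_lt_top (measure_lt_top μ _)

theorem integral_withDensity_ofReal {α : Type*} [MeasurableSpace α] (μ : Measure α)
    {p : α → ℝ} (hp : Measurable p) (hp0 : ∀ x, 0 ≤ p x) (g : α → ℝ) :
    ∫ x, g x ∂(μ.withDensity fun x => ENNReal.ofReal (p x)) = ∫ x, p x * g x ∂μ := by
  rw [integral_withDensity_eq_integral_toReal_smul hp.ennreal_ofReal
    (Eventually.of_forall fun _ => ENNReal.ofReal_lt_top)]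
  simp [ENNReal.toReal_ofReal, hp0]

variable {X : Type} [MeasurableSpace X]

theorem isFiniteMeasure_noisyLaw (Dx : Measure X) [IsFiniteMeasure Dx] {f : X → Bool}
    {ν : X → ℝ} (hν : ∀ x, 0 ≤ ν x ∧ ν x ≤ 1) : IsFiniteMeasure (noisyLaw Dx f ν) := by
  have h1 := isFiniteMeasure_withDensity_of_le Dx (p := fun x => 1 - ν x) (B := 1)
    fun x => by linarith [(hν x).1]
  have h2 := isFiniteMeasure_withDensity_of_le Dx (p := ν) (B := 1) fun x => (hν x).2
  unfold noisyLaw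
  infer_instance

theorem integral_noisyLaw (Dx : Measure X) [IsFiniteMeasure Dx] {f : X → Bool}
    (hf : Measurable f) {ν : X → ℝ} (hνm : Measurable ν) (hν : ∀ x, 0 ≤ ν x ∧ ν x ≤ 1)
    {q : X × Bool → ℝ} (hq : Measurable q) (hq1 : ∀ z, |q z| ≤ 1) :
    ∫ z, q z ∂(noisyLaw Dx f ν) =
      ∫ x, ((1 - ν x) * q (x, f x) + ν x * q (x, !f x)) ∂Dx := by
  have h1 := isFiniteMeasure_withDensity_of_le Dx (p := fun x => 1 - ν x) (B := 1)
    fun x => by linarith [(hν x).1]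
  have h2 := isFiniteMeasure_withDensity_of_le Dx (p := ν) (B := 1) fun x => (hν x).2
  have hm1 : Measurable fun x => (x, f x) := measurable_id.prodMk hf
  have hm2 : Measurable fun x => (x, !f x) :=
    measurable_id.prodMk ((measurable_from_top (f := not)).comp hf)
  have hab : ∀ {s t : ℝ}, 0 ≤ s → s ≤ 1 → |t| ≤ 1 → |s * t| ≤ 1 := by
    intro s t h1 h2 h3
    rw [abs_mul, abs_of_nonneg h1]
    exact mul_le_one₀ h2 (abs_nonneg _) h3
  unfold noisyLaw
  rw [integral_add_measure (integrable_of_abs_le hq hq1) (integrable_of_abs_le hq hq1),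
    integral_map hm1.aemeasurable hq.aestronglyMeasurable,
    integral_map hm2.aemeasurable hq.aestronglyMeasurable,
    integral_withDensity_ofReal _ (by fun_prop) (fun x => by linarith [(hν x).2]),
    integral_withDensity_ofReal _ hνm (fun x => (hν x).1), integral_add]
  · exact integrable_of_abs_le ((by fun_prop : Measurable fun x => 1 - ν x).mul (hq.comp hm1))
      fun x => hab (by linarith [(hν x).2]) (by linarith [(hν x).1]) (hq1 _)
  · exact integrable_of_abs_le (hνm.mul (hq.comp hm2)) fun x => hab (hν x).1 (hν x).2 (hq1 _)

theorem measurable_halfspace {M : ℕ} (w : Dom M) (θ : ℝ) : Measurable (halfspace w θ) := by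
  apply measurable_to_bool
  have : halfspace w θ ⁻¹' {true} = {x | 0 ≤ inner ℝ w x - θ} := by
    ext x
    simp [halfspace]
  rw [this]
  exact measurableSet_le measurable_const (by fun_prop)

/-- The query for the misclassification error of a hypothesis. -/
def errorQuery (h : Hypothesis X) : Query X where
  toFun z := if h.toFun z.1 ≠ z.2 then 1 else 0
  measurable_toFun := by
    apply Measurable.ite _ measurable_const measurable_const
    exact (measurableSet_eq_fun (h.measurable_toFun.comp measurable_fst) measurable_snd).compl
  mem_Icc z := by split_ifs <;> simp

/-- Misclassification is itself a query, so the estimate for queries also rules out hypotheses that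
are good for many selections. -/
theorem misclassError_eq_integral (D : Measure (X × Bool)) (h : Hypothesis X) :
    misclassError D h = ∫ z, (errorQuery h).toFun z ∂D := by
  have hm : MeasurableSet {z : X × Bool | h.toFun z.1 ≠ z.2} :=
    (measurableSet_eq_fun (h.measurable_toFun.comp measurable_fst) measurable_snd).compl
  have : (errorQuery h).toFun = {z : X × Bool | h.toFun z.1 ≠ z.2}.indicator fun _ => 1 := by
    ext z
    simp [errorQuery, Set.indicator_apply]
  rw [this, integral_indicator hm]
  simp [misclassError]

theorem Query.abs_le_one (q : Query X) (z : X × Bool) : |q.toFun z| ≤ 1 :=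
  abs_le.mpr (q.mem_Icc z)

end NoisyLaw

/-! ### The hard family of Massart halfspaces -/

section Family

variable {ε : ℝ} {J : ℕ}

/-- The normalizing constant of the labelled densities along an `n`-fold sum. -/
def totalMass (n : ℕ) (ε : ℝ) (J : ℕ) : ℝ :=
  avg^[n] (posDensity ε) 0 + avg^[n] (negDensity ε J) 0

theorem integral_totalMass {n : ℕ} (hε : 0 < ε) (hε' : ε ≤ 1 / 2) (hJ : 1 ≤ J)
    (v : Fin n → Bool) :
    ∫ x, (posDensity ε (proj v x) + negDensity ε J (proj v x)) ∂(cubeMeasure n) =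
      totalMass n ε J := by
  have h1 := integral_comp_proj v (measurable_posDensity hε) (abs_posDensity_le hε hε') 0
  have h2 := integral_comp_proj v (measurable_negDensity hε J) (abs_negDensity_le hε hε' hJ) 0
  simp only [zero_add] at h1 h2
  rw [integral_add, h1, h2, totalMass]
  · exact integrable_of_abs_le ((measurable_posDensity hε).comp (measurable_proj v))
      fun _ => abs_posDensity_le hε hε' _
  · exact integrable_of_abs_le ((measurable_negDensity hε J).comp (measurable_proj v))
      fun _ => abs_negDensity_le hε hε' hJ _

theorem abs_integral_combDensity_sub_one_le {n : ℕ} (hε : 0 < ε) (hε' : ε ≤ 1 / 2) {a : ℝ}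
    (ha : a = 1 / 4 ∨ a = -(1 / 4)) (v : Fin n → Bool) :
    |∫ x, combDensity ε a (proj v x) ∂(cubeMeasure n) - 1| ≤ 8 / ε * ε ^ n := by
  have h := integral_comp_proj v ((measurable_combDensity hε a).sub measurable_const)
    (abs_combDensity_sub_one_le hε hε' ha) 0
  simp only [zero_add, Pi.sub_apply] at h
  rw [integral_sub] at h
  · simp only [integral_const, probReal_univ, one_smul] at h
    rw [h]
    exact abs_avg_iterate_combDensity_le hε hε' ha n 0
  · refine integrable_of_abs_le ((measurable_combDensity hε a).comp (measurable_proj v))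
      (B := 7 / ε) fun x => ?_
    rw [abs_of_nonneg (combDensity_nonneg hε _ _)]
    exact combDensity_le hε hε' ha _
  · exact integrable_const _

/-- The normalizing constant is almost that of the flattened picture, where both combs equal 1. -/
theorem abs_totalMass_sub_le {n : ℕ} (hε : 0 < ε) (hε' : ε ≤ 1 / 2) (hJ : 1 ≤ J) :
    |totalMass n ε J - (1 + (1 - 2 / (2 * (J : ℝ) + 1)))| ≤
      (1 + (1 - 2 / (2 * (J : ℝ) + 1))) * (8 / ε * ε ^ n) := by
  let v : Fin n → Bool := fun _ => true
  have h1 := integral_comp_proj v (measurable_posDensity hε) (abs_posDensity_le hε hε') 0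
  have h2 := integral_comp_proj v (measurable_negDensity hε J) (abs_negDensity_le hε hε' hJ) 0
  simp only [zero_add] at h1 h2
  have h3 := abs_integral_combDensity_sub_one_le hε hε' (Or.inr rfl) v
  have h4 := abs_integral_combDensity_sub_one_le hε hε' (Or.inl rfl) v
  rw [totalMass, ← h1, ← h2]
  unfold posDensity negDensity
  rw [integral_const_mul]
  set β := 1 - 2 / (2 * (J : ℝ) + 1)
  have hβ : 0 < β := (bias_mem hJ).1
  rw [abs_le] at h3 h4 ⊢
  constructor <;> nlinarith [h3.1, h3.2, mul_le_mul_of_nonneg_left h4.1 hβ.le,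
    mul_le_mul_of_nonneg_left h4.2 hβ.le]

/-- The family of Massart halfspaces with a hidden direction. -/
theorem exists_family {n M : ℕ} {η OPT : ℝ} (hε : 0 < ε) (hε' : ε ≤ 1 / 2) (hJ : 1 ≤ J)
    (hM : ∀ d : ℕ, (d : ℝ) ≤ 24 * J ^ 2 / ε → (2 * n + 1) ^ d ≤ M)
    (hη : (1 - 1 / (2 * (J : ℝ) + 2) ^ 2) / 2 ≤ η)
    (hOPT : 6 * Real.exp (-(1 / (2 * ε ^ 2 * n))) ≤ OPT)
    (hZ : 1 ≤ totalMass n ε J) :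
    ∃ D : (Fin n → Bool) → Measure (Dom M × Bool), (∀ v, D v ∈ massartHalfspaces M η OPT) ∧
      ∃ Φ : (Fin n → ℝ × ℝ) → Dom M, Measurable Φ ∧ ∀ v (q : Query (Dom M)),
        ∫ z, q.toFun z ∂(D v) = 1 / totalMass n ε J *
          ∫ x, (q.toFun (Φ x, true) * posDensity ε (proj v x) +
            q.toFun (Φ x, false) * negDensity ε J (proj v x)) ∂(cubeMeasure n) := by
  classical
  obtain ⟨ι, _, r, hι, hd, hr⟩ := exists_roots hε hε' hJ
  obtain ⟨Φ, hΦ, hw⟩ := exists_embedding (n := n) hι (hM _ hd) r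
  choose w hw' using fun v => (hw v).1
  choose u hu using fun v => (hw v).2
  set Z := totalMass n ε J with hZdef
  have hZ0 : 0 < Z := by linarith
  let tot : ℝ → ℝ := fun z => posDensity ε z + negDensity ε J z
  have htotm : Measurable tot := (measurable_posDensity hε).add (measurable_negDensity hε J)
  have htot0 : ∀ z, 0 ≤ tot z := fun z =>
    add_nonneg (posDensity_nonneg hε z) (negDensity_nonneg hε hJ z)
  have htotB : ∀ z, tot z ≤ 14 / ε := fun z => by
    have h1 := (le_abs_self _).trans (abs_posDensity_le hε hε' z)
    have h2 := (le_abs_self _).trans (abs_negDensity_le hε hε' hJ z)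
    calc tot z ≤ 7 / ε + 7 / ε := add_le_add h1 h2
      _ = _ := by ring
  -- The functional `u v` recovers `proj v` from the embedded point. Where `tot` vanishes the
  -- quotient is 0 by convention, and `errDensity` vanishes there too.
  let ν : (Fin n → Bool) → Dom M → ℝ := fun v x =>
    errDensity ε J r (inner ℝ (u v) x) / tot (inner ℝ (u v) x)
  have hγ : (1 - 1 / (2 * (J : ℝ) + 2) ^ 2) / 2 ≤ 1 := by
    have : 0 ≤ 1 / (2 * (J : ℝ) + 2) ^ 2 := by positivity
    linarith
  have hγ0 : 0 ≤ (1 - 1 / (2 * (J : ℝ) + 2) ^ 2) / 2 := by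
    have : 1 / (2 * (J : ℝ) + 2) ^ 2 ≤ 1 := by
      rw [div_le_one (by positivity)]
      nlinarith [Nat.cast_nonneg (α := ℝ) J]
    linarith
  have hν0 : ∀ v x, 0 ≤ ν v x := fun v x =>
    div_nonneg (errDensity_nonneg r hε hJ _) (htot0 _)
  have hνγ : ∀ v x, ν v x ≤ (1 - 1 / (2 * (J : ℝ) + 2) ^ 2) / 2 := fun v x =>
    div_le_of_le_mul₀ (htot0 _) hγ0 (hr _).1
  have hν1 : ∀ v x, 0 ≤ ν v x ∧ ν v x ≤ 1 := fun v x => ⟨hν0 v x, (hνγ v x).trans hγ⟩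
  have hνm : ∀ v, Measurable (ν v) := by
    intro v
    have hin : Measurable fun x : Dom M => inner ℝ (u v) x := by fun_prop
    exact ((measurable_errDensity r hε J).comp hin).div (htotm.comp hin)
  let Dx : (Fin n → Bool) → Measure (Dom M) := fun v =>
    ((cubeMeasure n).withDensity fun x => ENNReal.ofReal (tot (proj v x) / Z)).map Φ
  have hpm : ∀ v, Measurable fun x : Fin n → ℝ × ℝ => tot (proj v x) / Z := fun v =>
    (htotm.comp (measurable_proj v)).div_const _
  have hp0 : ∀ v (x : Fin n → ℝ × ℝ), 0 ≤ tot (proj v x) / Z := fun v x =>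
    div_nonneg (htot0 _) hZ0.le
  have hprob : ∀ v, IsProbabilityMeasure (Dx v) := by
    intro v
    constructor
    simp only [Dx]
    rw [Measure.map_apply hΦ MeasurableSet.univ, Set.preimage_univ,
      withDensity_apply _ MeasurableSet.univ, Measure.restrict_univ,
      ← ofReal_integral_eq_lintegral_ofReal, integral_div,
      integral_totalMass hε hε' hJ v, div_self hZ0.ne', ENNReal.ofReal_one]
    · refine integrable_of_abs_le (hpm v) (B := 14 / ε / Z) fun x => ?_
      rw [abs_of_nonneg (hp0 v x)]
      gcongr
      exact htotB _
    · exact Eventually.of_forall (hp0 v)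
  let D : (Fin n → Bool) → Measure (Dom M × Bool) := fun v =>
    noisyLaw (Dx v) (halfspace (w v) 0) (ν v)
  have hD : ∀ v (q : Dom M × Bool → ℝ), Measurable q → (∀ z, |q z| ≤ 1) →
      ∫ z, q z ∂(D v) = 1 / Z * ∫ x, (q (Φ x, true) * posDensity ε (proj v x) +
        q (Φ x, false) * negDensity ε J (proj v x)) ∂(cubeMeasure n) := by
    intro v q hq hq1
    have := hprob v
    have hgm : Measurable fun x => (1 - ν v x) * q (x, halfspace (w v) 0 x) +
        ν v x * q (x, !halfspace (w v) 0 x) := by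
      have hf := measurable_halfspace (w v) 0
      have hν := hνm v
      exact ((measurable_const.sub hν).mul (hq.comp (measurable_id.prodMk hf))).add
        (hν.mul (hq.comp (measurable_id.prodMk ((measurable_from_top (f := not)).comp hf))))
    rw [integral_noisyLaw (Dx v) (measurable_halfspace (w v) 0) (hνm v) (hν1 v) hq hq1,
      integral_map hΦ.aemeasurable hgm.aestronglyMeasurable,
      integral_withDensity_ofReal _ (hpm v) (hp0 v), ← integral_const_mul]
    congr 1
    ext x
    have h1 : tot (proj v x) * ν v (Φ x) = errDensity ε J r (proj v x) := by
      simp only [ν, hu]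
      rcases eq_or_ne (tot (proj v x)) 0 with h | h
      · have h2 := (hr (proj v x)).1
        change _ ≤ _ * tot (proj v x) at h2
        rw [h, mul_zero] at h2
        rw [h, zero_mul]
        exact le_antisymm (errDensity_nonneg r hε hJ _) h2
      · field_simp
    have h2 : tot (proj v x) / Z * ((1 - ν v (Φ x)) * q (Φ x, halfspace (w v) 0 (Φ x)) +
        ν v (Φ x) * q (Φ x, !halfspace (w v) 0 (Φ x))) =
        1 / Z * ((tot (proj v x) - errDensity ε J r (proj v x)) *
          q (Φ x, halfspace (w v) 0 (Φ x)) +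
          errDensity ε J r (proj v x) * q (Φ x, !halfspace (w v) 0 (Φ x))) := by
      rw [← h1]
      ring
    rw [h2]
    congr 1
    have h3 : halfspace (w v) 0 (Φ x) = decide (0 ≤ ∏ t, (proj v x - r t)) := by
      simp only [halfspace, sub_zero, hw']
    rw [h3]
    unfold errDensity
    by_cases h : 0 ≤ ∏ t, (proj v x - r t)
    · simp only [h, if_true, decide_true, Bool.not_true, tot]
      ring
    · simp only [h, if_false, decide_false, Bool.not_false, tot]
      ring
  refine ⟨D, fun v => ⟨⟨Dx v, w v, 0, ν v, hprob v, hνm v,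
    fun x => ⟨hν0 v x, (hνγ v x).trans hη⟩, rfl⟩, ?_⟩, Φ, hΦ, fun v q =>
    hD v q.toFun q.measurable_toFun q.abs_le_one⟩
  have := hprob v
  have hfin : IsFiniteMeasure (D v) := isFiniteMeasure_noisyLaw (Dx v) (hν1 v)
  refine (iInf₂_le (w v) 0).trans ?_
  rw [← ENNReal.ofReal_toReal (measure_ne_top (D v) _)]
  apply ENNReal.ofReal_le_ofReal
  let h : Hypothesis (Dom M) := ⟨halfspace (w v) 0, measurable_halfspace (w v) 0⟩
  change misclassError (D v) h ≤ OPT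
  rw [misclassError_eq_integral, hD v _ (errorQuery h).measurable_toFun (errorQuery h).abs_le_one]
  -- The hidden halfspace errs with density `errDensity`, which is zero in the bulk and at most 3
  -- outside it.
  have hbound : ∀ x, (errorQuery h).toFun (Φ x, true) * posDensity ε (proj v x) +
      (errorQuery h).toFun (Φ x, false) * negDensity ε J (proj v x) ≤
      {x | 1 / (2 * ε) ≤ |proj v x|}.indicator (fun _ => (3 : ℝ)) x := by
    intro x
    have h1 : (errorQuery h).toFun (Φ x, true) * posDensity ε (proj v x) +
        (errorQuery h).toFun (Φ x, false) * negDensity ε J (proj v x) =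
        errDensity ε J r (proj v x) := by
      simp only [errorQuery, h, halfspace, sub_zero, hw', errDensity]
      by_cases h : 0 ≤ ∏ t, (proj v x - r t) <;> simp [h]
    rw [h1]
    by_cases hx : 1 / (2 * ε) ≤ |proj v x|
    · rw [Set.indicator_of_mem (by exact hx)]
      exact errDensity_le_three r hε hJ hx
    · rw [Set.indicator_of_notMem (by exact hx)]
      exact ((hr _).2 (not_le.mp hx)).le
  have hms : MeasurableSet {x : Fin n → ℝ × ℝ | 1 / (2 * ε) ≤ |proj v x|} :=
    measurableSet_le measurable_const (measurable_proj v).abs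
  have hQm : ∀ b, Measurable fun x => (errorQuery h).toFun (Φ x, b) := fun b =>
    (errorQuery h).measurable_toFun.comp (hΦ.prodMk measurable_const)
  have hint : ∫ x, ((errorQuery h).toFun (Φ x, true) * posDensity ε (proj v x) +
      (errorQuery h).toFun (Φ x, false) * negDensity ε J (proj v x)) ∂(cubeMeasure n) ≤
      3 * (2 * Real.exp (-(2 * (1 / (2 * ε)) ^ 2 / n))) := by
    calc _ ≤ ∫ x, {x | 1 / (2 * ε) ≤ |proj v x|}.indicator (fun _ => (3 : ℝ)) x
          ∂(cubeMeasure n) := by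
          refine integral_mono ?_ ((integrable_const _).indicator hms) hbound
          refine Integrable.add ?_ ?_
          · refine integrable_of_abs_le ((hQm true).mul
              ((measurable_posDensity hε).comp (measurable_proj v))) (B := 1 * (7 / ε)) fun x => ?_
            rw [abs_mul]
            exact mul_le_mul ((errorQuery h).abs_le_one _) (abs_posDensity_le hε hε' _)
              (abs_nonneg _) zero_le_one
          · refine integrable_of_abs_le ((hQm false).mul
              ((measurable_negDensity hε J).comp (measurable_proj v))) (B := 1 * (7 / ε))
              fun x => ?_
            rw [abs_mul]
            exact mul_le_mul ((errorQuery h).abs_le_one _) (abs_negDensity_le hε hε' hJ _)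
              (abs_nonneg _) zero_le_one
      _ = 3 * (cubeMeasure n).real {x | 1 / (2 * ε) ≤ |proj v x|} := by
          rw [integral_indicator hms]
          simp [mul_comm]
      _ ≤ _ := by
          gcongr
          exact measure_proj_ge_le v (by positivity)
  have e : -(2 * (1 / (2 * ε)) ^ 2 / n) = -(1 / (2 * ε ^ 2 * n)) := by
    rcases eq_or_ne (n : ℝ) 0 with h | h
    · simp [h]
    · field_simp
  rw [e] at hint
  have h1Z : 1 / Z ≤ 1 := by
    rw [div_le_one hZ0]; exact hZ
  calc _ ≤ 1 / Z * (3 * (2 * Real.exp (-(1 / (2 * ε ^ 2 * n))))) := by gcongr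
    _ ≤ 1 * (3 * (2 * Real.exp (-(1 / (2 * ε ^ 2 * n))))) := by gcongr
    _ ≤ OPT := by linarith

end Family

/-! ### SQ hardness for admissible parameters -/

section Hardness

variable {ε : ℝ} {J : ℕ}

theorem card_filter_lt_abs_le {ι : Type} [Fintype ι] (x : ι → ℝ) {t S : ℝ} (ht : 0 < t)
    [DecidablePred fun i => t < |x i|] (h : ∑ i, |x i| ≤ S) :
    ((Finset.univ.filter fun i => t < |x i|).card : ℝ) ≤ S / t := by
  rw [le_div_iff₀ ht]
  calc ((Finset.univ.filter fun i => t < |x i|).card : ℝ) * t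
      = ∑ i ∈ Finset.univ.filter fun i => t < |x i|, t := by simp
    _ ≤ ∑ i ∈ Finset.univ.filter fun i => t < |x i|, |x i| :=
        Finset.sum_le_sum fun i hi => (Finset.mem_filter.mp hi).2.le
    _ ≤ ∑ i, |x i| := Finset.sum_le_sum_of_subset_of_nonneg (Finset.filter_subset _ _)
        fun i _ _ => abs_nonneg _
    _ ≤ S := h

theorem sum_abs_integral_mul_combDensity_le {n : ℕ} (hε : 0 < ε) (hε' : ε ≤ 1 / 2) {a : ℝ}
    (ha : a = 1 / 4 ∨ a = -(1 / 4)) {q : (Fin n → ℝ × ℝ) → ℝ} (hq : Measurable q)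
    (hq1 : ∀ x, |q x| ≤ 1) :
    ∑ v : Fin n → Bool, |∫ x, q x * (combDensity ε a (proj v x) - 1) ∂(cubeMeasure n)| ≤
      8 / ε * (7 / 4) ^ n := by
  refine (sum_abs_integral_mul_proj_le (g := fun z => combDensity ε a z - 1)
    ((measurable_combDensity hε a).sub measurable_const)
    (abs_avg_iterate_combDensity_le hε hε' ha) hq hq1).trans ?_
  gcongr
  -- Here 2(1 + ε) ≤ 3 ≤ (7/4)²; the gain is that 7/4 < 2, the number of selections being 2^n.
  rw [Real.sqrt_le_iff]
  refine ⟨by positivity, ?_⟩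
  rw [← pow_mul, mul_comm n 2, pow_mul]
  gcongr
  linarith

/-- SQ hardness, given parameters that satisfy the required inequalities. -/
theorem sqHard_of_parameters {n M : ℕ} {η OPT τ c : ℝ} (hε : 0 < ε) (hε' : ε ≤ 1 / 2)
    (hJ : 1 ≤ J) (hM : ∀ d : ℕ, (d : ℝ) ≤ 24 * J ^ 2 / ε → (2 * n + 1) ^ d ≤ M)
    (hη : (1 - 1 / (2 * (J : ℝ) + 2) ^ 2) / 2 ≤ η)
    (hOPT : 6 * Real.exp (-(1 / (2 * ε ^ 2 * n))) ≤ OPT)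
    (hJc : 1 / (J : ℝ) ≤ c) (hc : c ≤ 1 / 2) (hδ : 8 / ε * ε ^ n ≤ c / 4) (hτ : 0 < τ)
    (hcard : 16 / ε * (7 / 8) ^ n * (1 / τ ^ 2 + 2 / c) < 2 / 3) :
    SQHard M η OPT τ (1 / 2 - c) := by
  classical
  have hJ' : (1 : ℝ) ≤ J := by exact_mod_cast hJ
  have hc0 : 0 < c := lt_of_lt_of_le (by positivity) hJc
  have hZ := abs_totalMass_sub_le (n := n) hε hε' hJ
  set β := 1 - 2 / (2 * (J : ℝ) + 1) with hβdef
  have hβ : 0 < β := (bias_mem hJ).1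
  have hβ1 : β ≤ 1 := (bias_mem hJ).2
  have hβ3 : 1 / 3 ≤ β := by
    have : 2 / (2 * (J : ℝ) + 1) ≤ 2 / 3 := by gcongr; linarith
    linarith
  have hβJ : (1 / 2 - 1 / (4 * J)) * (1 + β) = β := by
    rw [hβdef]
    field_simp
    ring
  have hZ' := hZ.trans (mul_le_mul_of_nonneg_left hδ (by linarith))
  rw [abs_le] at hZ'
  have hZlow : (1 + β) * (7 / 8) ≤ totalMass n ε J := by nlinarith [hZ'.1]
  have hZup : totalMass n ε J ≤ (1 + β) * (1 + c / 4) := by nlinarith [hZ'.2]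
  have hZ1 : 1 ≤ totalMass n ε J := by linarith
  obtain ⟨D, hD, Φ, hΦ, hq⟩ := exists_family (n := n) hε hε' hJ hM hη hOPT hZ1
  set Z := totalMass n ε J
  have hZ0 : 0 < Z := by linarith
  -- The common answers: both combs are replaced by 1, so `v` no longer appears.
  let R : Query (Dom M) → ℝ := fun q => 1 / Z *
    (∫ x, q.toFun (Φ x, true) ∂(cubeMeasure n) + β * ∫ x, q.toFun (Φ x, false) ∂(cubeMeasure n))
  have hQm : ∀ (q : Query (Dom M)) b, Measurable fun x => q.toFun (Φ x, b) := fun q b =>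
    q.measurable_toFun.comp (hΦ.prodMk measurable_const)
  have hQi : ∀ (q : Query (Dom M)) b, Integrable (fun x => q.toFun (Φ x, b)) (cubeMeasure n) :=
    fun q b => integrable_of_abs_le (hQm q b) fun _ => q.abs_le_one _
  have hdiff : ∀ v (q : Query (Dom M)), ∫ z, q.toFun z ∂(D v) - R q = 1 / Z *
      (∫ x, q.toFun (Φ x, true) * (combDensity ε (-(1 / 4)) (proj v x) - 1) ∂(cubeMeasure n) +
        β * ∫ x, q.toFun (Φ x, false) * (combDensity ε (1 / 4) (proj v x) - 1)
          ∂(cubeMeasure n)) := by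
    intro v q
    have hi : ∀ b a, (a = 1 / 4 ∨ a = -(1 / 4)) → Integrable
        (fun x => q.toFun (Φ x, b) * combDensity ε a (proj v x)) (cubeMeasure n) := by
      intro b a ha
      refine integrable_of_abs_le ((hQm q b).mul
        ((measurable_combDensity hε a).comp (measurable_proj v))) (B := 1 * (7 / ε)) fun x => ?_
      rw [abs_mul]
      refine mul_le_mul (q.abs_le_one _) ?_ (abs_nonneg _) zero_le_one
      rw [abs_of_nonneg (combDensity_nonneg hε _ _)]
      exact combDensity_le hε hε' ha _
    rw [hq]
    simp only [R, mul_sub, mul_one]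
    rw [integral_sub (hi _ _ (Or.inr rfl)) (hQi _ _), integral_sub (hi _ _ (Or.inl rfl)) (hQi _ _)]
    have : ∀ x, q.toFun (Φ x, true) * posDensity ε (proj v x) +
        q.toFun (Φ x, false) * negDensity ε J (proj v x) =
        q.toFun (Φ x, true) * combDensity ε (-(1 / 4)) (proj v x) +
        β * (q.toFun (Φ x, false) * combDensity ε (1 / 4) (proj v x)) := by
      intro x
      unfold posDensity negDensity
      ring
    simp only [this]
    rw [integral_add (hi _ _ (Or.inr rfl)) ((hi _ _ (Or.inl rfl)).const_mul _),
      integral_const_mul]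
    ring
  have hsum : ∀ q : Query (Dom M), ∑ v, |∫ z, q.toFun z ∂(D v) - R q| ≤
      16 / ε * (7 / 8) ^ n * Fintype.card (Fin n → Bool) := by
    intro q
    have h1 := sum_abs_integral_mul_combDensity_le hε hε' (Or.inr rfl) (hQm q true)
      fun _ => q.abs_le_one _
    have h2 := sum_abs_integral_mul_combDensity_le hε hε' (Or.inl rfl) (hQm q false)
      fun _ => q.abs_le_one _
    calc ∑ v, |∫ z, q.toFun z ∂(D v) - R q|
        ≤ ∑ v, 1 / Z * (|∫ x, q.toFun (Φ x, true) *
            (combDensity ε (-(1 / 4)) (proj v x) - 1) ∂(cubeMeasure n)| +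
          β * |∫ x, q.toFun (Φ x, false) * (combDensity ε (1 / 4) (proj v x) - 1)
            ∂(cubeMeasure n)|) := by
          refine Finset.sum_le_sum fun v _ => ?_
          rw [hdiff, abs_mul, abs_of_pos (by positivity : 0 < 1 / Z)]
          gcongr
          refine (abs_add_le _ _).trans ?_
          rw [abs_mul β, abs_of_pos hβ]
      _ ≤ 1 / Z * (8 / ε * (7 / 4) ^ n + β * (8 / ε * (7 / 4) ^ n)) := by
          rw [← Finset.mul_sum, Finset.sum_add_distrib, ← Finset.mul_sum]
          gcongr
      _ = (1 + β) / Z * (8 / ε * (7 / 4) ^ n) := by ring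
      _ ≤ 2 * (8 / ε * (7 / 4) ^ n) := by
          gcongr
          rw [div_le_iff₀ hZ0]
          linarith
      _ = 16 / ε * (7 / 8) ^ n * Fintype.card (Fin n → Bool) := by
          have : (7 / 4 : ℝ) ^ n = (7 / 8) ^ n * 2 ^ n := by rw [← mul_pow]; norm_num
          simp only [Fintype.card_fun, Fintype.card_bool, Fintype.card_fin, Nat.cast_pow,
            Nat.cast_ofNat, this]
          ring
  intro Ω _ P _ A
  -- Both fractions come from Markov's inequality over `v`, with threshold τ for queries and c/2 for
  -- the error query of a hypothesis.
  refine not_learns_of_family D _ hD R (β := 16 / ε * (7 / 8) ^ n / τ)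
    (β' := 16 / ε * (7 / 8) ^ n / (c / 2)) hτ.le ?_ ?_ ?_ P A
  · intro q
    refine (card_filter_lt_abs_le _ hτ (hsum q)).trans (le_of_eq ?_)
    ring
  · intro h
    -- Each point costs any hypothesis either β or 1, hence at least β. Error below 1/2 - c
    -- therefore forces a deviation of more than c/2 from the common answer.
    have hR : 1 / 2 - c / 2 ≤ R (errorQuery h) := by
      have h1 : β ≤ ∫ x, (errorQuery h).toFun (Φ x, true) ∂(cubeMeasure n) +
          β * ∫ x, (errorQuery h).toFun (Φ x, false) ∂(cubeMeasure n) := by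
        rw [← integral_const_mul, ← integral_add (hQi _ _) ((hQi _ _).const_mul _)]
        calc β = ∫ x, β ∂(cubeMeasure n) := by simp
          _ ≤ _ := by
              refine integral_mono (integrable_const _)
                ((hQi _ _).add ((hQi _ _).const_mul _)) fun x => ?_
              simp only [errorQuery]
              cases h.toFun (Φ x) <;> simp [hβ1]
      have h2 : (1 / 2 - c / 2) * Z ≤ β := by
        have h3 : 1 / (4 * (J : ℝ)) ≤ c / 4 := by
          have : 1 / (4 * (J : ℝ)) = 1 / J / 4 := by field_simp
          rw [this]
          linarith
        calc (1 / 2 - c / 2) * Z ≤ (1 / 2 - c / 2) * ((1 + β) * (1 + c / 4)) := by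
              apply mul_le_mul_of_nonneg_left hZup; linarith
          _ = (1 / 2 - 3 * c / 8 - c ^ 2 / 8) * (1 + β) := by ring
          _ ≤ (1 / 2 - 1 / (4 * J)) * (1 + β) := by
              apply mul_le_mul_of_nonneg_right _ (by linarith)
              nlinarith
          _ = β := hβJ
      simp only [R]
      rw [div_mul_eq_mul_div, one_mul, le_div_iff₀ hZ0]
      exact h2.trans h1
    have hc2 : 0 < c / 2 := by positivity
    have h1 := card_filter_lt_abs_le _ hc2 (hsum (errorQuery h))
    refine le_trans ?_ (h1.trans (le_of_eq (by ring)))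
    norm_cast
    refine Finset.card_le_card fun v hv => ?_
    simp only [Finset.mem_filter, Finset.mem_univ, true_and] at hv ⊢
    rw [misclassError_eq_integral] at hv
    rw [lt_abs]
    right
    linarith
  · refine lt_of_eq_of_lt ?_ hcard
    field_simp

end Hardness

/-! ### Bounded dimension and trivial error levels -/

section SmallDimension

/-- A learner at the larger tolerance is also one at the smaller: oracles for τ are oracles for τ',
and the query budget only grows. -/
theorem SQHard.mono_tol {M : ℕ} {η OPT τ τ' e : ℝ} (h : SQHard M η OPT τ e) (hτ : 0 < τ)
    (hττ : τ ≤ τ') : SQHard M η OPT τ' e := by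
  intro Ω _ P _ A hL
  refine h Ω P A fun D hD O hO => ?_
  obtain ⟨h1, h2⟩ := hL D hD O fun q => ⟨by linarith [(hO q).1], by linarith [(hO q).2]⟩
  exact ⟨fun ω => (h1 ω).trans (one_div_le_one_div_of_le hτ hττ), h2⟩

/-- A point mass whose label is `b` with probability `1 - p`. -/
def noisyPoint (M : ℕ) (p : ℝ) (b : Bool) : Measure (Dom M × Bool) :=
  noisyLaw (Measure.dirac 0) (halfspace 0 (if b then 0 else 1)) fun _ => p

variable {M : ℕ} {p : ℝ}

theorem integral_noisyPoint (hp : 0 ≤ p) (hp1 : p ≤ 1) (b : Bool) (q : Query (Dom M)) :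
    ∫ z, q.toFun z ∂(noisyPoint M p b) = (1 - p) * q.toFun (0, b) + p * q.toFun (0, !b) := by
  have hb : halfspace (0 : Dom M) (if b then 0 else 1) 0 = b := by
    cases b <;> simp [halfspace]
  have hm : Measurable fun x : Dom M =>
      (1 - p) * q.toFun (x, halfspace 0 (if b then 0 else 1) x) +
        p * q.toFun (x, !halfspace 0 (if b then 0 else 1) x) := by
    have hf := measurable_halfspace (0 : Dom M) (if b then 0 else 1)
    exact ((q.measurable_toFun.comp (measurable_id.prodMk hf)).const_mul _).add
      ((q.measurable_toFun.comp (measurable_id.prodMk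
        ((measurable_from_top (f := not)).comp hf))).const_mul _)
  unfold noisyPoint
  rw [integral_noisyLaw _ (measurable_halfspace _ _) measurable_const (fun _ => ⟨hp, hp1⟩)
    q.measurable_toFun q.abs_le_one, integral_dirac, hb]

theorem misclassError_noisyPoint (hp : 0 ≤ p) (hp1 : p ≤ 1) (b : Bool) (h : Hypothesis (Dom M)) :
    misclassError (noisyPoint M p b) h = if h.toFun 0 = b then p else 1 - p := by
  rw [misclassError_eq_integral, integral_noisyPoint hp hp1]
  cases b <;> cases hh : h.toFun 0 <;> simp [errorQuery, hh]

theorem noisyPoint_mem {η : ℝ} (hp : 0 ≤ p) (hp1 : p ≤ 1) (hpη : p ≤ η) (b : Bool) :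
    noisyPoint M p b ∈ massartHalfspaces M η p := by
  refine ⟨⟨Measure.dirac 0, 0, _, fun _ => p, inferInstance, measurable_const,
    fun _ => ⟨hp, hpη⟩, rfl⟩, ?_⟩
  have hfin : IsFiniteMeasure (noisyPoint M p b) :=
    isFiniteMeasure_noisyLaw _ fun _ => ⟨hp, hp1⟩
  refine (iInf₂_le (0 : Dom M) (if b then 0 else 1)).trans ?_
  rw [← ENNReal.ofReal_toReal (measure_ne_top (noisyPoint M p b) _)]
  apply ENNReal.ofReal_le_ofReal
  let h : Hypothesis (Dom M) := ⟨halfspace 0 (if b then 0 else 1), measurable_halfspace _ _⟩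
  change misclassError (noisyPoint M p b) h ≤ p
  have hb : h.toFun 0 = b := by
    cases b <;> simp [h, halfspace]
  rw [misclassError_noisyPoint hp hp1, if_pos hb]

/-- Queries whose tolerance exceeds the bias of the labels are useless. -/
theorem sqHard_of_large_tolerance {η τ e : ℝ} (hp : 0 ≤ p) (hp1 : p ≤ 1 / 2) (hpη : p ≤ η)
    (hτ : 0 < τ) (hpτ : 1 - 2 * p ≤ τ) (he : e ≤ 1 / 2) : SQHard M η p τ e := by
  classical
  intro Ω _ P _ A
  have hp1' : p ≤ 1 := by linarith
  -- The midpoint answer is valid for both point masses, and any hypothesis labels the point wrongly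
  -- for one of them; the resulting 1/2 is below 2/3.
  refine not_learns_of_family (noisyPoint M p) _ (noisyPoint_mem hp hp1' hpη)
    (fun q => (q.toFun (0, true) + q.toFun (0, false)) / 2) (β := 0) (β' := 1 / 2) hτ.le
    ?_ ?_ (by norm_num) P A
  · intro q
    rw [zero_mul, Finset.filter_false_of_mem, Finset.card_empty, Nat.cast_zero]
    intro b _
    rw [not_lt, integral_noisyPoint hp hp1']
    have h1 := q.mem_Icc (0, true)
    have h2 := q.mem_Icc (0, false)
    refine le_trans ?_ hpτ
    rw [abs_le]
    cases b <;> simp only [Bool.not_true, Bool.not_false] <;> constructor <;>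
      nlinarith [h1.1, h1.2, h2.1, h2.2]
  · intro h
    have : (Finset.univ.filter fun b => misclassError (noisyPoint M p b) h < e) ⊆
        {h.toFun 0} := by
      intro b hb
      simp only [Finset.mem_filter, Finset.mem_univ, true_and] at hb
      rw [misclassError_noisyPoint hp hp1'] at hb
      rw [Finset.mem_singleton]
      by_contra hne
      rw [if_neg (fun h => hne h.symm)] at hb
      linarith
    have := Finset.card_le_card this
    rw [Finset.card_singleton] at this
    rw [Fintype.card_bool]
    have h1 := (Nat.cast_le (α := ℝ)).mpr this
    push_cast at h1 ⊢
    linarith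

theorem sqHard_of_nonpos {η τ e : ℝ} (hp : 0 ≤ p) (hp1 : p ≤ 1 / 2) (hpη : p ≤ η)
    (hτ : 0 < τ) (he : e ≤ 0) : SQHard M η p τ e := by
  intro Ω _ P _ A hL
  obtain ⟨-, E, -, hE, h⟩ := hL _ (noisyPoint_mem hp (by linarith) hpη true)
    (fun q => ∫ z, q.toFun z ∂(noisyPoint M p true)) fun q => ⟨by linarith, by linarith⟩
  have hne : E.Nonempty := by
    rw [Set.nonempty_iff_ne_empty]
    rintro rfl
    norm_num at hE
  obtain ⟨ω, hω⟩ := hne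
  have h1 := h ω hω
  have h2 : 0 ≤ misclassError (noisyPoint M p true) ((A ω).run
    fun q => ∫ z, q.toFun z ∂(noisyPoint M p true)) := measureReal_nonneg
  linarith

theorem tol_eq_exp {κ OPT : ℝ} (hM : 0 < M) :
    tol κ M OPT = Real.exp (-(κ * (Real.log M * logRatio M / Real.log (1 / OPT)))) := by
  unfold tol
  rw [Real.rpow_def_of_pos (by exact_mod_cast hM)]
  congr 1
  ring

theorem log_two_le_log_one_div {OPT : ℝ} (h0 : 0 < OPT) (h1 : OPT < 1 / 2) :
    Real.log 2 ≤ Real.log (1 / OPT) := by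
  apply Real.log_le_log two_pos
  rw [le_div_iff₀ h0]
  linarith

/-- In bounded dimension, if `κ` is small enough, the tolerance is too large for queries to be
useful. -/
theorem exists_sqHard_of_lt (M₀ : ℕ) : ∃ κ : ℝ, 0 < κ ∧ ∀ (M : ℕ) (OPT η e : ℝ), 0 < M → M < M₀ →
    0 < OPT → Real.log (1 / OPT) ≤ logRatio M → OPT < η → η ≤ 1 / 2 → e ≤ 1 / 2 →
    SQHard M η OPT (tol κ M OPT) e := by
  obtain ⟨L, hL1, hL⟩ : ∃ L : ℝ, 1 ≤ L ∧ ∀ M < M₀, logRatio M ≤ L := by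
    refine ⟨1 + ∑ M ∈ Finset.range M₀, |logRatio M|, ?_, fun M hM => ?_⟩
    · have : 0 ≤ ∑ M ∈ Finset.range M₀, |logRatio M| := Finset.sum_nonneg fun _ _ => abs_nonneg _
      linarith
    · have := Finset.single_le_sum (f := fun M => |logRatio M|) (fun _ _ => abs_nonneg _)
        (Finset.mem_range.mpr hM)
      linarith [le_abs_self (logRatio M)]
  have hlog2 : 0 < Real.log 2 := Real.log_pos one_lt_two
  set B : ℝ := (M₀ + 1) * L / Real.log 2 with hB
  have hB0 : 0 < B := by positivity
  -- With this κ the exponent y of the tolerance is at most 2 exp(-L) ≤ 2 OPT, so exp(-y) ≥ 1 - y ≥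
  -- 1 - 2 OPT, the bias of the label.
  refine ⟨2 * Real.exp (-L) / B, by positivity, ?_⟩
  intro M OPT η e hM hMM h0 hΛ hOη hη he
  have hΛ2 := log_two_le_log_one_div h0 (hOη.trans_le hη)
  have hΛ0 := hlog2.trans_le hΛ2
  refine sqHard_of_large_tolerance h0.le (by linarith) hOη.le ?_ ?_ he
  · rw [tol_eq_exp hM]
    positivity
  have hOL : Real.exp (-L) ≤ OPT := by
    rw [← Real.exp_log h0]
    apply Real.exp_le_exp.mpr
    rw [one_div, Real.log_inv] at hΛ
    linarith [hL M hMM]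
  have hlogM : Real.log M ≤ M₀ + 1 := by
    have h1 : (M : ℝ) ≤ M₀ := by exact_mod_cast hMM.le
    have h2 := Real.log_le_sub_one_of_pos (show (0 : ℝ) < M by exact_mod_cast hM)
    linarith
  have hlogM0 : 0 ≤ Real.log M := Real.log_natCast_nonneg M
  have hle : Real.log M * logRatio M / Real.log (1 / OPT) ≤ B := by
    rw [hB]
    have := hΛ0.le.trans hΛ
    gcongr
    exact hL M hMM
  rw [tol_eq_exp hM]
  have h3 : 2 * Real.exp (-L) / B * (Real.log M * logRatio M / Real.log (1 / OPT)) ≤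
      2 * Real.exp (-L) / B * B := by gcongr
  rw [div_mul_cancel₀ _ hB0.ne'] at h3
  have h4 := Real.add_one_le_exp
    (-(2 * Real.exp (-L) / B * (Real.log M * logRatio M / Real.log (1 / OPT))))
  linarith

end SmallDimension

/-! ### Choice of parameters in large dimension -/

section LargeDimension

/-- The factors n come from 1/ε ≤ 4n, and exp(n/25) bounds 1/τ² when κ = 1/100. What matters is
exp(1/25) < 8/7, so the factor (7/8)^n wins. -/
theorem eventually_parameter_bounds {c : ℝ} (hc : 0 < c) : ∀ᶠ n : ℕ in atTop,
    32 * n * (1 / 2) ^ n ≤ c / 4 ∧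
      64 * n * (7 / 8) ^ n * (Real.exp (n / 25) + 2 / c) < 2 / 3 := by
  have hexp : Real.exp (1 / 25) < 8 / 7 := by
    have := Real.exp_bound_div_one_sub_of_interval (x := 1 / 25) (by norm_num) (by norm_num)
    exact this.trans_lt (by norm_num)
  have h1 := tendsto_self_mul_const_pow_of_lt_one (r := 1 / 2) (by norm_num) (by norm_num)
  have h2 := tendsto_self_mul_const_pow_of_lt_one (r := 7 / 8) (by norm_num) (by norm_num)
  have h3 := tendsto_self_mul_const_pow_of_lt_one (r := 7 / 8 * Real.exp (1 / 25))
    (by positivity) (by linarith)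
  have h4 := h1.const_mul 32
  have h5 := (h3.const_mul 64).add (h2.const_mul (64 * (2 / c)))
  simp only [mul_zero, add_zero] at h4 h5
  filter_upwards [h4.eventually_le_const (by positivity : 0 < c / 4),
    h5.eventually_lt_const (by norm_num : (0 : ℝ) < 2 / 3)] with n h6 h7
  refine ⟨by linarith, lt_of_eq_of_lt ?_ h7⟩
  have : Real.exp (n / 25) = Real.exp (1 / 25) ^ n := by
    rw [← Real.exp_nat_mul]
    congr 1
    ring
  rw [this, mul_pow]
  ring

/-- The constant 6 works because 2J + 2 ≤ 2/c + 4 ≤ 4/c leaves a gap of at least c²/32 below 1/2,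
while the hypothesis puts η within c²/36 of 1/2. -/
theorem noise_rate_bound {c η : ℝ} {J : ℕ} (hc : 0 < c) (hc2 : c ≤ 1 / 2) (hη : η ≤ 1 / 2)
    (hJ : (J : ℝ) ≤ 1 / c + 1) (hK : 6 * √(1 / 2 - η) ≤ c) :
    (1 - 1 / (2 * (J : ℝ) + 2) ^ 2) / 2 ≤ η := by
  have h1 : 1 / 2 - η ≤ c ^ 2 / 36 := by
    have h2 := Real.sq_sqrt (show 0 ≤ 1 / 2 - η by linarith)
    nlinarith [Real.sqrt_nonneg (1 / 2 - η)]
  have h2 : 2 * (J : ℝ) + 2 ≤ 4 / c := by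
    have : 2 ≤ 1 / c := by rw [le_div_iff₀ hc]; linarith
    have e : 4 / c = 4 * (1 / c) := by ring
    rw [e]
    linarith
  have h3 : c ^ 2 / 16 ≤ 1 / (2 * (J : ℝ) + 2) ^ 2 := by
    calc c ^ 2 / 16 = 1 / (4 / c) ^ 2 := by field_simp; norm_num
      _ ≤ _ := by gcongr
  nlinarith [sq_nonneg c]

/-- The number of monomials of the threshold polynomial is at most `M`. -/
theorem pow_le_of_degree_le {M J n d : ℕ} {Λ : ℝ} (hM : 0 < M) (hl : 3 ≤ Real.log M)
    (hs0 : 0 < Real.log (Real.log M)) (hs : 41472 * (J : ℝ) ^ 4 ≤ Real.log (Real.log M))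
    (hn : (n : ℝ) ≤ Real.log M ^ 2) (hΛ : 0 < Λ)
    (hnΛ : n * Λ * Real.log (Real.log M) ^ 3 ≤ Real.log M ^ 2)
    (hd : (d : ℝ) ≤ 24 * J ^ 2 * √(8 * n * Λ)) : (2 * n + 1) ^ d ≤ M := by
  set l := Real.log M with hl_def
  set s := Real.log l
  have hsq : √(8 * n * Λ) ^ 2 = 8 * n * Λ := Real.sq_sqrt (by positivity)
  have hlogn : Real.log (2 * n + 1) ≤ 3 * s := by
    have : (2 * n + 1 : ℝ) ≤ l ^ 3 := by
      have h1 : 3 * l ^ 2 ≤ l ^ 3 := by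
        rw [pow_succ l 2, mul_comm]
        gcongr
      nlinarith
    calc Real.log (2 * n + 1) ≤ Real.log (l ^ 3) := Real.log_le_log (by positivity) this
      _ = 3 * s := by rw [Real.log_pow]; push_cast; rfl
  have hlogn0 : 0 ≤ Real.log (2 * n + 1) :=
    Real.log_nonneg (by linarith [Nat.cast_nonneg (α := ℝ) n])
  -- After squaring, log n costs two factors s = log log M. The third factor absorbs the constant
  -- 41472 J⁴, where 41472 = (24 · 3)² · 8.
  have hmain : d * Real.log (2 * n + 1) ≤ l := by
    apply le_of_sq_le_sq _ (by linarith)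
    calc (d * Real.log (2 * n + 1)) ^ 2
        ≤ (24 * J ^ 2 * √(8 * n * Λ) * (3 * s)) ^ 2 := by gcongr
      _ = 41472 * J ^ 4 * (n * Λ * s ^ 2) := by
          rw [mul_pow, mul_pow _ (√(8 * n * Λ)), hsq]
          ring
      _ ≤ s * (n * Λ * s ^ 2) := by gcongr
      _ = n * Λ * s ^ 3 := by ring
      _ ≤ l ^ 2 := hnΛ
  have h1 : ((2 * n + 1 : ℕ) : ℝ) ^ d ≤ M := by
    rw [← Real.log_le_log_iff (by positivity) (by exact_mod_cast hM), Real.log_pow]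
    push_cast
    exact hmain
  exact_mod_cast h1

/-- The spacing ε = 1/√(8nΛ) balances degree against tail: the tail becomes exp(-4Λ) = OPT⁴, small
enough for 6 OPT⁴ ≤ OPT when OPT < 1/2. -/
theorem exists_spacing {n Λ : ℝ} (hn : 2 ≤ n) (hΛ : 1 / 2 ≤ Λ) (hΛn : Λ ≤ 2 * n) :
    ∃ ε : ℝ, 0 < ε ∧ ε ≤ 1 / 2 ∧ 1 / ε = √(8 * n * Λ) ∧ 1 / ε ≤ 4 * n ∧
      1 / (2 * ε ^ 2 * n) = 4 * Λ := by
  have h8 : 0 < 8 * n * Λ := by positivity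
  have hsq : √(8 * n * Λ) ^ 2 = 8 * n * Λ := Real.sq_sqrt h8.le
  refine ⟨1 / √(8 * n * Λ), by positivity, ?_, one_div_one_div _, ?_, ?_⟩
  · apply one_div_le_one_div_of_le two_pos
    apply Real.le_sqrt_of_sq_le
    nlinarith
  · rw [one_div_one_div, Real.sqrt_le_iff]
    refine ⟨by positivity, ?_⟩
    nlinarith
  · rw [div_pow, hsq]
    field_simp
    norm_num

/-- Hardness in large dimension. -/
theorem exists_sqHard_of_ge {c : ℝ} (hc : 0 < c) (hc2 : c ≤ 1 / 2) :
    ∃ M₀ : ℕ, ∀ (M : ℕ) (OPT η : ℝ), M₀ ≤ M → 0 < OPT → Real.log (1 / OPT) ≤ logRatio M →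
      OPT < η → η ≤ 1 / 2 → 6 * √(1 / 2 - η) ≤ c →
      SQHard M η OPT (tol (1 / 100) M OPT) (1 / 2 - c) := by
  obtain ⟨n₀, hn₀⟩ := eventually_atTop.mp (eventually_parameter_bounds hc)
  set J := ⌈1 / c⌉₊ with hJdef
  have hJ : 1 ≤ J := Nat.one_le_ceil_iff.mpr (by positivity)
  have hJle : 1 / c ≤ J := Nat.le_ceil _
  have hJlt : (J : ℝ) < 1 / c + 1 := Nat.ceil_lt_add_one (by positivity)
  have hJ' : (1 : ℝ) ≤ J := by exact_mod_cast hJ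
  have hlog : Tendsto (fun M : ℕ => Real.log M) atTop atTop :=
    Real.tendsto_log_atTop.comp tendsto_natCast_atTop_atTop
  have hloglog := Real.tendsto_log_atTop.comp hlog
  obtain ⟨M₀, hM₀⟩ := eventually_atTop.mp ((hlog.eventually_ge_atTop (n₀ + 3 : ℝ)).and
    (hloglog.eventually_ge_atTop (41472 * (J : ℝ) ^ 4)))
  refine ⟨M₀, fun M OPT η hM h0 hΛ hOη hη hK => ?_⟩
  obtain ⟨hl, hll⟩ := hM₀ M hM
  simp only [Function.comp_apply] at hll
  have hOPT2 : OPT < 1 / 2 := hOη.trans_le hη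
  have hΛ2 := log_two_le_log_one_div h0 hOPT2
  have hlog2 : 1 / 2 < Real.log 2 := by linarith [Real.log_two_gt_d9]
  have hratio : logRatio M = Real.log M / Real.log (Real.log M) ^ 3 := rfl
  have hOPTexp : Real.exp (-Real.log (1 / OPT)) = OPT := by
    rw [one_div, Real.log_inv, neg_neg, Real.exp_log h0]
  have hMpos : 0 < M := by
    rcases Nat.eq_zero_or_pos M with rfl | h
    · simp at hl
      linarith [Nat.cast_nonneg (α := ℝ) n₀]
    · exact h
  have htol := tol_eq_exp (κ := 1 / 100) (OPT := OPT) hMpos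
  rw [hratio] at hΛ htol
  set l := Real.log M with hldef
  set s := Real.log l with hsdef
  set Λ := Real.log (1 / OPT)
  have hs : 41472 ≤ s := by
    have : 1 ≤ (J : ℝ) ^ 4 := one_le_pow₀ hJ'
    linarith
  have hl3 : 3 ≤ l := by linarith [Nat.cast_nonneg (α := ℝ) n₀]
  have hs0 : 0 < s := by linarith
  have hs3 : 0 < s ^ 3 := by positivity
  have hΛ0 : 0 < Λ := by linarith
  -- The tolerance is exp(-X/100), and n is the integer part of X. The hypothesis Λ ≤ l/s³ is used
  -- as X ≥ l, which makes n large and gives Λ ≤ 2n.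
  set X := l * (l / s ^ 3) / Λ with hX
  have hX0 : 0 ≤ X := by positivity
  have hXl : l ≤ X := by
    rw [hX, le_div_iff₀ hΛ0]
    gcongr
  have hsΛ : 1 ≤ s ^ 3 * Λ := by
    have : (2 : ℝ) ^ 3 ≤ s ^ 3 := by gcongr; linarith
    nlinarith
  have hXl2 : X ≤ l ^ 2 := by
    have : X = l ^ 2 / (s ^ 3 * Λ) := by rw [hX]; field_simp
    rw [this]
    exact div_le_self (by positivity) hsΛ
  have hΛl : Λ ≤ l := hΛ.trans (div_le_self (by linarith) (one_le_pow₀ (by linarith)))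
  set n := ⌊X⌋₊ with hn
  have hnX : (n : ℝ) ≤ X := Nat.floor_le hX0
  have hXn : X < n + 1 := Nat.lt_floor_add_one X
  have hn0 : n₀ ≤ n := by
    apply Nat.le_floor
    linarith
  have hn1 : (2 : ℝ) ≤ n := by linarith
  obtain ⟨hb1, hb2⟩ := hn₀ n hn0
  obtain ⟨ε, hε, hε', hεinv, hε4, hεexp⟩ :=
    exists_spacing hn1 (hlog2.le.trans hΛ2) (by linarith : Λ ≤ 2 * n)
  have hτ0 : 0 < tol (1 / 100) M OPT := by
    rw [htol]
    positivity
  refine sqHard_of_parameters (n := n) (J := J) hε hε' hJ ?_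
    (noise_rate_bound hc hc2 hη hJlt.le hK) ?_ ?_ hc2 ?_ hτ0 ?_
  · intro d hd
    have hd' : (d : ℝ) ≤ 24 * J ^ 2 * √(8 * n * Λ) := by
      rw [← hεinv]
      exact hd.trans (le_of_eq (by ring))
    have hnΛ : n * Λ * s ^ 3 ≤ l ^ 2 := by
      have : X * Λ * s ^ 3 = l ^ 2 := by rw [hX]; field_simp
      rw [← this]
      gcongr
    exact pow_le_of_degree_le hMpos hl3 hs0 hll (hnX.trans hXl2) hΛ0 hnΛ hd'
  · rw [hεexp, show -(4 * Λ) = ((4 : ℕ) : ℝ) * (-Λ) by push_cast; ring, Real.exp_nat_mul, hOPTexp]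
    have : OPT ^ 3 ≤ (1 / 2) ^ 3 := by gcongr
    nlinarith
  · rw [div_le_iff₀ (by positivity)]
    rw [div_le_iff₀ hc] at hJle
    linarith
  · calc 8 / ε * ε ^ n = 8 * (1 / ε) * ε ^ n := by ring
      _ ≤ 8 * (4 * n) * (1 / 2) ^ n := by gcongr
      _ = 32 * n * (1 / 2) ^ n := by ring
      _ ≤ c / 4 := hb1
  · refine lt_of_le_of_lt ?_ hb2
    -- Here 1/τ² = exp(X/50) with X < n + 1 ≤ 2n.
    have h1 : 1 / tol (1 / 100) M OPT ^ 2 ≤ Real.exp (n / 25) := by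
      rw [htol, ← Real.exp_nat_mul, one_div, ← Real.exp_neg]
      apply Real.exp_le_exp.mpr
      push_cast
      linarith
    calc 16 / ε * (7 / 8) ^ n * (1 / tol (1 / 100) M OPT ^ 2 + 2 / c)
        = 16 * (1 / ε) * (7 / 8) ^ n * (1 / tol (1 / 100) M OPT ^ 2 + 2 / c) := by ring
      _ ≤ 16 * (4 * n) * (7 / 8) ^ n * (Real.exp (n / 25) + 2 / c) := by gcongr
      _ = _ := by ring

end LargeDimension

/-! ### Assembling the regimes -/

section Conclusion

theorem tol_le_tol {κ κ' OPT : ℝ} {M : ℕ} (hM : 0 < M) (h : 0 ≤ logRatio M)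
    (hΛ : 0 ≤ Real.log (1 / OPT)) (hκ : κ ≤ κ') : tol κ' M OPT ≤ tol κ M OPT := by
  rw [tol_eq_exp hM, tol_eq_exp hM]
  apply Real.exp_le_exp.mpr
  apply neg_le_neg
  apply mul_le_mul_of_nonneg_right hκ
  exact div_nonneg (mul_nonneg (Real.log_natCast_nonneg M) h) hΛ

/-- For c ≥ 1/2 the target error is not positive and any κ works. Otherwise the constants for
bounded and for large M are combined by taking the smaller κ, since lowering κ raises the tolerance.
-/
theorem exists_sqHard {c : ℝ} (hc : 0 < c) : ∃ κ : ℝ, 0 < κ ∧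
    ∀ (M : ℕ) (OPT η : ℝ), 0 < M → 0 < OPT → Real.log (1 / OPT) ≤ logRatio M →
      OPT < η → η ≤ 1 / 2 → 6 * √(1 / 2 - η) ≤ c →
      SQHard M η OPT (tol κ M OPT) (1 / 2 - c) := by
  have htol : ∀ (κ : ℝ) (M : ℕ) (OPT : ℝ), 0 < M → 0 < tol κ M OPT := fun κ M OPT hM => by
    rw [tol_eq_exp hM]
    positivity
  rcases le_total c (1 / 2) with hc2 | hc2
  · obtain ⟨M₀, hlarge⟩ := exists_sqHard_of_ge hc hc2
    obtain ⟨κ, hκ, hsmall⟩ := exists_sqHard_of_lt M₀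
    refine ⟨min κ (1 / 100), lt_min hκ (by norm_num), fun M OPT η hM h0 hΛ hOη hη hK => ?_⟩
    have hΛ0 : 0 ≤ Real.log (1 / OPT) :=
      (Real.log_nonneg one_le_two).trans (log_two_le_log_one_div h0 (hOη.trans_le hη))
    have hmono : ∀ κ', min κ (1 / 100) ≤ κ' → SQHard M η OPT (tol κ' M OPT) (1 / 2 - c) →
        SQHard M η OPT (tol (min κ (1 / 100)) M OPT) (1 / 2 - c) := fun κ' hκ' h =>
      h.mono_tol (htol _ _ _ hM) (tol_le_tol hM (hΛ0.trans hΛ) hΛ0 hκ')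
    rcases lt_or_ge M M₀ with hMM | hMM
    · exact hmono κ (min_le_left _ _)
        (hsmall M OPT η _ hM hMM h0 hΛ hOη hη (by linarith))
    · exact hmono _ (min_le_right _ _) (hlarge M OPT η hMM h0 hΛ hOη hη hK)
  · refine ⟨1, one_pos, fun M OPT η hM h0 _ hOη hη _ => ?_⟩
    exact sqHard_of_nonpos h0.le (by linarith) hOη.le (htol _ _ _ hM) (by linarith)

theorem tendsto_log_natCast : Tendsto (fun M : ℕ => Real.log M) atTop atTop :=
  Real.tendsto_log_atTop.comp tendsto_natCast_atTop_atTop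

theorem eventually_rpow_log_le_logRatio {c' : ℝ} (hc' : c' < 1) :
    ∀ᶠ M : ℕ in atTop, Real.log M ^ c' ≤ logRatio M := by
  have h := (isLittleO_log_rpow_rpow_atTop 3 (show 0 < 1 - c' by linarith)).bound
    (zero_lt_one (α := ℝ))
  filter_upwards [tendsto_log_natCast.eventually h,
    tendsto_log_natCast.eventually_gt_atTop 1] with M h1 h2
  have hs : 0 < Real.log (Real.log M) := Real.log_pos h2
  have hl : 0 < Real.log M := by linarith
  rw [one_mul, Real.norm_of_nonneg (by positivity), Real.norm_of_nonneg (by positivity)] at h1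
  have h3 : Real.log (Real.log M) ^ (3 : ℝ) = Real.log (Real.log M) ^ 3 := by
    exact_mod_cast Real.rpow_natCast (Real.log (Real.log M)) 3
  rw [h3] at h1
  unfold logRatio
  rw [le_div_iff₀ (by positivity)]
  calc Real.log M ^ c' * Real.log (Real.log M) ^ 3 ≤ Real.log M ^ c' * Real.log M ^ (1 - c') := by
        gcongr
    _ = Real.log M := by
        rw [← Real.rpow_add hl]
        simp

theorem eventually_exp_neg_rpow_log_lt {c' η : ℝ} (hc' : 0 < c') (hη : 0 < η) :
    ∀ᶠ M : ℕ in atTop, Real.exp (-(Real.log M) ^ c') < η := by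
  have h : Tendsto (fun M : ℕ => Real.exp (-(Real.log M) ^ c')) atTop (𝓝 0) :=
    Real.tendsto_exp_neg_atTop_nhds_zero.comp
      ((tendsto_rpow_atTop hc').comp tendsto_log_natCast)
  exact h.eventually_lt_const hη

end Conclusion

end MassartSQ

end

/-- The constants `C` ("sufficiently large constant multiple") and `K` (`c ≫ √(1/2 - η)`) are
universal; `κ`, the constant of `Ω_c`, depends only on `c`. The first part is the hardness result;
the second specializes it to `OPT = exp (-(log M)^{c'})`; the third is the resulting error lower
bound `η - o_η(1)`. -/
theorem mainTheorem3 :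
    ∃ C K : ℝ, 0 < C ∧ 0 < K ∧
      (∀ c : ℝ, 0 < c → ∃ κ : ℝ, 0 < κ ∧
        (∀ (M : ℕ) (OPT η : ℝ), 0 < M → 0 < OPT →
          C * Real.log (1 / OPT) ≤ MassartSQ.logRatio M →
          OPT < η → η ≤ 1 / 2 → K * Real.sqrt (1 / 2 - η) ≤ c →
          MassartSQ.SQHard M η OPT (MassartSQ.tol κ M OPT) (1 / 2 - c)) ∧
        (∀ c' : ℝ, 0 < c' → c' < 1 → ∃ M₀ : ℕ, ∀ (M : ℕ) (η : ℝ), M₀ ≤ M →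
          Real.exp (-(Real.log M) ^ c') < η → η ≤ 1 / 2 → K * Real.sqrt (1 / 2 - η) ≤ c →
          MassartSQ.SQHard M η (Real.exp (-(Real.log M) ^ c'))
            (MassartSQ.tol κ M (Real.exp (-(Real.log M) ^ c'))) (1 / 2 - c))) ∧
      (∃ g : ℝ → ℝ, Tendsto g (𝓝[<] (1 / 2)) (𝓝 0) ∧
        ∀ η : ℝ, 0 < η → η < 1 / 2 → ∃ κ : ℝ, 0 < κ ∧
          ∀ c' : ℝ, 0 < c' → c' < 1 → ∃ M₀ : ℕ, ∀ M : ℕ, M₀ ≤ M →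
            MassartSQ.SQHard M η (Real.exp (-(Real.log M) ^ c'))
              (MassartSQ.tol κ M (Real.exp (-(Real.log M) ^ c'))) (η - g η)) := by
  have hpart : ∀ c : ℝ, 0 < c → ∃ κ : ℝ, 0 < κ ∧
      (∀ (M : ℕ) (OPT η : ℝ), 0 < M → 0 < OPT →
        1 * Real.log (1 / OPT) ≤ MassartSQ.logRatio M →
        OPT < η → η ≤ 1 / 2 → 6 * Real.sqrt (1 / 2 - η) ≤ c →
        MassartSQ.SQHard M η OPT (MassartSQ.tol κ M OPT) (1 / 2 - c)) ∧
      (∀ c' : ℝ, 0 < c' → c' < 1 → ∃ M₀ : ℕ, ∀ (M : ℕ) (η : ℝ), M₀ ≤ M →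
        Real.exp (-(Real.log M) ^ c') < η → η ≤ 1 / 2 → 6 * Real.sqrt (1 / 2 - η) ≤ c →
        MassartSQ.SQHard M η (Real.exp (-(Real.log M) ^ c'))
          (MassartSQ.tol κ M (Real.exp (-(Real.log M) ^ c'))) (1 / 2 - c)) := by
    intro c hc
    obtain ⟨κ, hκ, h⟩ := MassartSQ.exists_sqHard hc
    refine ⟨κ, hκ, fun M OPT η hM h0 hΛ => h M OPT η hM h0 (by rwa [one_mul] at hΛ), ?_⟩
    intro c' _ hc'
    obtain ⟨M₀, hM₀⟩ := eventually_atTop.mp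
      ((MassartSQ.eventually_rpow_log_le_logRatio hc').and (eventually_gt_atTop 0))
    refine ⟨M₀, fun M η hM => h M _ η (hM₀ M hM).2 (Real.exp_pos _) ?_⟩
    rw [one_div, ← Real.exp_neg, neg_neg, Real.log_exp]
    exact (hM₀ M hM).1
  -- The function g makes η - g(η) = 1/2 - c for the smallest admissible c = 6√(1/2 - η), which is
  -- positive for η < 1/2.
  refine ⟨1, 6, one_pos, by norm_num, hpart, fun η => η - 1 / 2 + 6 * Real.sqrt (1 / 2 - η), ?_, ?_⟩
  · have h : Continuous fun η : ℝ => η - 1 / 2 + 6 * Real.sqrt (1 / 2 - η) := by fun_prop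
    have h' := h.tendsto (1 / 2)
    simp only [sub_self, Real.sqrt_zero, mul_zero, add_zero] at h'
    exact h'.mono_left nhdsWithin_le_nhds
  · intro η hη0 hη
    have hc : 0 < 6 * Real.sqrt (1 / 2 - η) := by
      have : 0 < Real.sqrt (1 / 2 - η) := Real.sqrt_pos.mpr (by linarith)
      positivity
    obtain ⟨κ, hκ, -, h⟩ := hpart _ hc
    refine ⟨κ, hκ, fun c' hc0 hc1 => ?_⟩
    obtain ⟨M₁, hM₁⟩ := h c' hc0 hc1
    obtain ⟨M₂, hM₂⟩ := eventually_atTop.mp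
      (MassartSQ.eventually_exp_neg_rpow_log_lt hc0 hη0)
    refine ⟨max M₁ M₂, fun M hM => ?_⟩
    have h1 := hM₁ M η (le_of_max_le_left hM) (hM₂ M (le_of_max_le_right hM)) hη.le le_rfl
    convert h1 using 1
    ring
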